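/- **Theorem (double robustness and asymptotic normality).** Let $O=(X,A,W,Y)\sim P$, where $X$ and $W$ take values in arbitrary measurable spaces, $A\in\{0,1\}$ and $Y\in\mathbb{R}$, and let $O_1,O_2,\dots$ be i.i.d. copies of $O$. Put $$Q(a,w,x)=\mathbb{E}_P(Y\mid A=a,W=w,X=x),\qquad g_0(w,x)=\mathbb{P}(A=1\mid W=w,X=x),$$ $$\Delta(w,x)=Q(1,w,x)-Q(0,w,x),\qquad \psi(P)=\mathbb{E}_P\{\Delta(W,X)\},$$ $$\varphi_\psi(O)=\frac{\mathbf 1\{A=1\}}{g_0(W,X)}\{Y-Q(1,W,X)\}-\frac{\mathbf 1\{A=0\}}{1-g_0(W,X)}\{Y-Q(0,W,X)\}+\Delta(W,X)-\psi(P).$$ For $f=f(w,x)$ write $\|f\|_{L_2(P)}=(\mathbb{E}_P f(W,X)^2)^{1/2}\in[0,\infty]$. Fix $K\ge 2$. For each $n$ let $\mathcal I_1,\dots,\mathcal I_K$ be a random partition of $\{1,\dots,n\}$, independent of the data, into approximately equal folds, meaning $|\mathcal I_k|/n\to 1/K$ in probability for each $k$. For each $k$ let $\widehat Q^{(-k)}$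 and $\widehat g^{(-k)}$ be estimators of $Q$ and $g_0$ computed only from the training sample $\{O_j: j\notin\mathcal I_k\}$ (given the partition, measurable jointly in the training sample and the argument $(w,x)$). For $i\in\mathcal I_k$ let $$\widehat\phi^{\mathrm{cf}}_i=\frac{\mathbf 1\{A_i=1\}}{\widehat g^{(-k)}(W_i,X_i)}\{Y_i-\widehat Q^{(-k)}(1,W_i,X_i)\}-\frac{\mathbf 1\{A_i=0\}}{1-\widehat g^{(-k)}(W_i,X_i)}\{Y_i-\widehat Q^{(-k)}(0,W_i,X_i)\}+\widehat Q^{(-k)}(1,W_i,X_i)-\widehat Q^{(-k)}(0,W_i,X_i),$$ and let $$\widehat\psi_{\mathrm{cf}}=\frac1n\sum_{k=1}^K\sum_{i\in\mathcal I_k}\widehat\phi^{\mathrm{cf}}_i,\qquad \widehat{\mathrm{SE}}=\sqrt{\frac{1}{n(n-1)}\sum_{i=1}^n\bigl(\widehat\phi^{\mathrm{cf}}_i-\widehat\psi_{\mathrm{cf}}\bigr)^2}.$$ Write $$e_Q=\max_{k}\sum_{a=0}^1\|\widehat Q^{(-k)}(a,\cdot)-Q(a,\cdot)\|_{L_2(P)},\qquad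 e_g=\max_k\|\widehat g^{(-k)}-g_0\|_{L_2(P)}.$$ Assume that $Y\in L_2(P)$, that $Q(a,\cdot)\in L_2(P)$ for $a=0,1$, that $\varepsilon_0\le g_0(W,X)\le 1-\varepsilon_0$ almost surely for some $\varepsilon_0>0$, and that for some $\varepsilon>0$, with probability tending to $1$ as $n\to\infty$, $\varepsilon\le\widehat g^{(-k)}(w,x)\le 1-\varepsilon$ for all $(w,x)$ and all $k$. Then: (i) If either $e_Q=o_P(1)$, or $e_g=o_P(1)$ together with $\max_k\sum_{a}\|\widehat Q^{(-k)}(a,\cdot)\|_{L_2(P)}=O_P(1)$, then $\widehat\psi_{\mathrm{cf}}\to\psi(P)$ in probability. (ii) If $e_Q=o_P(1)$, $e_g=o_P(1)$ and $e_g\,e_Q=o_P(n^{-1/2})$, then $\varphi_\psi(O)$ has finite variance $\sigma^2=\operatorname{var}_P\{\varphi_\psi(O)\}$ and $$\sqrt n\,\{\widehat\psi_{\mathrm{cf}}-\psi(P)\}\overset{d}{\longrightarrow}N(0,\sigma^2).$$ (iii) Under the conditions of (ii), $\widehat{\mathrm{SE}}$ is an asymptotically valid standard error: $\sqrt n\,\widehat{\mathrm{SE}}\to\sigma$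 in probability and, if $\sigma^2>0$, then $\{\widehat\psi_{\mathrm{cf}}-\psi(P)\}/\widehat{\mathrm{SE}}\overset{d}{\longrightarrow}N(0,1)$ and, for every $z>0$, $\mathbb{P}\bigl(\psi(P)\in[\widehat\psi_{\mathrm{cf}}-z\,\widehat{\mathrm{SE}},\ \widehat\psi_{\mathrm{cf}}+z\,\widehat{\mathrm{SE}}]\bigr)\to \mathbb{P}(|Z|\le z)$ with $Z\sim N(0,1)$. -/

import Mathlib

open MeasureTheory ProbabilityTheory Filter
open scoped ENNReal NNReal Topology

noncomputable section

namespace DirectEffect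

/-- An observation `O = (X, A, W, Y)`: covariates, binary exposure, focal variable, outcome. -/
abbrev Obs (𝓧 𝓦 : Type*) : Type _ := 𝓧 × Fin 2 × 𝓦 × ℝ

section Observed

variable {𝓧 𝓦 : Type*}

/-- The exposure `A`. -/
def expo (o : Obs 𝓧 𝓦) : Fin 2 := o.2.1

/-- The pair `(W, X)`. -/
def covs (o : Obs 𝓧 𝓦) : 𝓦 × 𝓧 := (o.2.2.1, o.1)

/-- The outcome `Y`. -/
def outcome (o : Obs 𝓧 𝓦) : ℝ := o.2.2.2

/-- The uncentered one-step score with outcome regressions `Q` and propensity `g`: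
`1{A=1}/g(W,X) * (Y - Q(1,W,X)) - 1{A=0}/(1-g(W,X)) * (Y - Q(0,W,X)) + Q(1,W,X) - Q(0,W,X)`. -/
def score (Q : Fin 2 → 𝓦 × 𝓧 → ℝ) (g : 𝓦 × 𝓧 → ℝ) (o : Obs 𝓧 𝓦) : ℝ :=
  (if expo o = 1 then 1 else 0) / g (covs o) * (outcome o - Q 1 (covs o))
    - (if expo o = 0 then 1 else 0) / (1 - g (covs o)) * (outcome o - Q 0 (covs o))
    + Q 1 (covs o) - Q 0 (covs o)

end Observed

section Population

variable {𝓧 𝓦 : Type*} [MeasurableSpace 𝓧] [MeasurableSpace 𝓦]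

/-- `Q(a,w,x) = E_P(Y | A = a, W = w, X = x)`, the mean of the regular conditional law of `Y`
given `(A, W, X)`. -/
def outcomeReg (P : Measure (Obs 𝓧 𝓦)) [IsFiniteMeasure P] (a : Fin 2) (wx : 𝓦 × 𝓧) : ℝ :=
  ∫ y, y ∂(condDistrib (outcome : Obs 𝓧 𝓦 → ℝ) (fun o => (expo o, covs o)) P (a, wx))

/-- `g₀(w,x) = P(A = 1 | W = w, X = x)`. -/
def propensity (P : Measure (Obs 𝓧 𝓦)) [IsFiniteMeasure P] (wx : 𝓦 × 𝓧) : ℝ :=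
  (condDistrib (expo : Obs 𝓧 𝓦 → Fin 2) covs P wx).real {1}

/-- `Δ(w,x) = Q(1,w,x) - Q(0,w,x)`. -/
def contrast (P : Measure (Obs 𝓧 𝓦)) [IsFiniteMeasure P] (wx : 𝓦 × 𝓧) : ℝ :=
  outcomeReg P 1 wx - outcomeReg P 0 wx

/-- The target parameter `ψ(P) = E_P{Δ(W,X)}`. -/
def psi (P : Measure (Obs 𝓧 𝓦)) [IsFiniteMeasure P] : ℝ := ∫ o, contrast P (covs o) ∂P

/-- The influence function `φ_ψ(O)`. -/
def influence (P : Measure (Obs 𝓧 𝓦)) [IsFiniteMeasure P] (o : Obs 𝓧 𝓦) : ℝ :=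
  score (outcomeReg P) (propensity P) o - psi P

/-- The `L₂(P)` norm (possibly `∞`) of a function of `(W, X)`. -/
def l2norm (P : Measure (Obs 𝓧 𝓦)) (f : 𝓦 × 𝓧 → ℝ) : ℝ≥0∞ := eLpNorm (fun o => f (covs o)) 2 P

end Population

section CrossFitting

variable {𝓧 𝓦 : Type*} {K n : ℕ}

/-- A partition of the index set `{1, …, n}` into `K` folds is encoded by the function `s` that
sends an index to its fold; this is the `k`-th fold `I_k`. -/
def fold (s : Fin n → Fin K) (k : Fin K) : Finset (Fin n) := Finset.univ.filter fun i => s i = k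

/-- A possible value of the training sample `(O_j : j ∈ I_{-k})`. -/
abbrev Training (𝓧 𝓦 : Type*) (s : Fin n → Fin K) (k : Fin K) : Type _ :=
  {j : Fin n // s j ≠ k} → Obs 𝓧 𝓦

/-- The training sample `(O_j : j ∈ I_{-k})` of the sample `d`. -/
def training (s : Fin n → Fin K) (k : Fin K) (d : Fin n → Obs 𝓧 𝓦) : Training 𝓧 𝓦 s k :=
  fun j => d j

/-- A procedure that, for each sample size, partition into `K` folds and fold `k`, computes an
estimate with values in `F` from the training sample of that fold alone. -/
abbrev Learner (𝓧 𝓦 : Type*) (K : ℕ) (F : Type*) : Type _ :=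
  ∀ (n : ℕ) (s : Fin n → Fin K) (k : Fin K), Training 𝓧 𝓦 s k → F

/-- The held-out score contribution of observation `i`, whose fold is `s i`. -/
def heldOutScore (Qhat : Learner 𝓧 𝓦 K (Fin 2 → 𝓦 × 𝓧 → ℝ)) (ghat : Learner 𝓧 𝓦 K (𝓦 × 𝓧 → ℝ))
    (s : Fin n → Fin K) (d : Fin n → Obs 𝓧 𝓦) (i : Fin n) : ℝ :=
  score (Qhat n s (s i) (training s (s i) d)) (ghat n s (s i) (training s (s i) d)) (d i)

/-- The `K`-fold cross-fitted one-step estimator. -/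
def psiCF (Qhat : Learner 𝓧 𝓦 K (Fin 2 → 𝓦 × 𝓧 → ℝ)) (ghat : Learner 𝓧 𝓦 K (𝓦 × 𝓧 → ℝ))
    (s : Fin n → Fin K) (d : Fin n → Obs 𝓧 𝓦) : ℝ :=
  1 / (n : ℝ) * ∑ k : Fin K, ∑ i ∈ fold s k, heldOutScore Qhat ghat s d i

/-- The plug-in standard error. -/
def seCF (Qhat : Learner 𝓧 𝓦 K (Fin 2 → 𝓦 × 𝓧 → ℝ)) (ghat : Learner 𝓧 𝓦 K (𝓦 × 𝓧 → ℝ))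
    (s : Fin n → Fin K) (d : Fin n → Obs 𝓧 𝓦) : ℝ :=
  √(1 / ((n : ℝ) * ((n : ℝ) - 1)) *
    ∑ i : Fin n, (heldOutScore Qhat ghat s d i - psiCF Qhat ghat s d) ^ 2)

variable [MeasurableSpace 𝓧] [MeasurableSpace 𝓦]

/-- `max_k ∑_a ‖Qhat^{(-k)}(a,·) - Q(a,·)‖_{L₂(P)}`. -/
def outcomeError (P : Measure (Obs 𝓧 𝓦)) [IsFiniteMeasure P]
    (Qhat : Learner 𝓧 𝓦 K (Fin 2 → 𝓦 × 𝓧 → ℝ)) (s : Fin n → Fin K) (d : Fin n → Obs 𝓧 𝓦) : ℝ≥0∞ :=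
  ⨆ k : Fin K, ∑ a : Fin 2,
    l2norm P (fun wx => Qhat n s k (training s k d) a wx - outcomeReg P a wx)

/-- `max_k ∑_a ‖Qhat^{(-k)}(a,·)‖_{L₂(P)}`. -/
def outcomeSize (P : Measure (Obs 𝓧 𝓦))
    (Qhat : Learner 𝓧 𝓦 K (Fin 2 → 𝓦 × 𝓧 → ℝ)) (s : Fin n → Fin K) (d : Fin n → Obs 𝓧 𝓦) : ℝ≥0∞ :=
  ⨆ k : Fin K, ∑ a : Fin 2, l2norm P (Qhat n s k (training s k d) a)

/-- `max_k ‖ghat^{(-k)} - g₀‖_{L₂(P)}`. -/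
def propensityError (P : Measure (Obs 𝓧 𝓦)) [IsFiniteMeasure P]
    (ghat : Learner 𝓧 𝓦 K (𝓦 × 𝓧 → ℝ)) (s : Fin n → Fin K) (d : Fin n → Obs 𝓧 𝓦) : ℝ≥0∞ :=
  ⨆ k : Fin K, l2norm P (fun wx => ghat n s k (training s k d) wx - propensity P wx)

end CrossFitting

section Orders

variable {Ω : Type*} [MeasurableSpace Ω]

/-- `Z_n = o_P(r_n)` for nonnegative extended-real `Z_n`. -/
def IsLittleOP (μ : Measure Ω) (Z : ℕ → Ω → ℝ≥0∞) (r : ℕ → ℝ≥0∞) : Prop :=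
  ∀ δ : ℝ≥0, 0 < δ → Tendsto (fun n => μ {ω | δ * r n < Z n ω}) atTop (𝓝 0)

/-- `Z_n = O_P(r_n)` for nonnegative extended-real `Z_n`. -/
def IsBigOP (μ : Measure Ω) (Z : ℕ → Ω → ℝ≥0∞) (r : ℕ → ℝ≥0∞) : Prop :=
  ∀ η : ℝ≥0, 0 < η → ∃ M : ℝ≥0, ∀ᶠ n in atTop, μ {ω | M * r n < Z n ω} ≤ η

end Orders

end DirectEffect

end

/-! Each held-out score equals ψ(P), plus the influence function at that observation, plus an error:
the score at the fitted nuisances minus the score at the true ones (`heldOutScore_eq`). The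
influence terms are i.i.d., centred and square-integrable, so the strong law and the central limit
theorem apply to them. It remains to show that the average error is o_P(1) for consistency and
o_P(n^{-1/2}) for normality, and that the mean squared error is o_P(1) for the standard error.

Given the partition and a training sample, the fitted functions are fixed and the held-out
observations are i.i.d. A fold sum is therefore its conditional mean plus a centred fluctuation. In
the conditional mean the outcome residual drops out by orthogonality, and replacing 1{A=1} by its
conditional mean leaves integrals of (ĝ - g₀) times (Q̂ - Q) over a propensity. Cauchy–Schwarz
bounds them by e_g e_Q / ε (`enorm_integral_scoreError_le`). This product structure is the double
robustness.

The fluctuation is handled by Chebyshev's inequality. A bounded L₂ norm of the error function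
suffices for consistency. The root-n statement needs that norm to tend to zero, which is
`exists_eLpNorm_scoreError_le`; since the residual is merely square-integrable, that lemma truncates
it. Fubini over the training and held-out blocks, then over the independent partition
(`measure_random_partition_le`), turns conditional bounds into unconditional ones.

The sample variance moves little when the sample is perturbed by an error of small mean square
(`abs_sampleVariance_sub_le`). Slutsky's theorem then gives the studentized limit, and the
portmanteau theorem gives coverage. -/

namespace DirectEffect

/-! ### Measurability of nuisances and scores -/

section Measurability

variable {𝓧 𝓦 : Type*} [MeasurableSpace 𝓧] [MeasurableSpace 𝓦]

@[fun_prop]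
lemma measurable_expo : Measurable (expo : Obs 𝓧 𝓦 → Fin 2) := by
  unfold expo; fun_prop

@[fun_prop]
lemma measurable_covs : Measurable (covs : Obs 𝓧 𝓦 → 𝓦 × 𝓧) := by
  unfold covs; fun_prop

@[fun_prop]
lemma measurable_outcome : Measurable (outcome : Obs 𝓧 𝓦 → ℝ) := by
  unfold outcome; fun_prop

@[fun_prop]
lemma measurable_indicator_expo (a : Fin 2) :
    Measurable fun o : Obs 𝓧 𝓦 => (if expo o = a then (1 : ℝ) else 0) :=
  (measurable_of_finite fun b : Fin 2 => if b = a then (1 : ℝ) else 0).comp measurable_expo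

lemma measurable_uncurry_outcomeReg (P : Measure (Obs 𝓧 𝓦)) [IsFiniteMeasure P] :
    Measurable fun p : Fin 2 × (𝓦 × 𝓧) => outcomeReg P p.1 p.2 :=
  (StronglyMeasurable.integral_condDistrib (μ := P) (Y := (outcome : Obs 𝓧 𝓦 → ℝ))
    (X := fun o : Obs 𝓧 𝓦 => (expo o, covs o)) (f := fun p => p.2)
    measurable_snd.stronglyMeasurable).measurable

@[fun_prop]
lemma measurable_outcomeReg (P : Measure (Obs 𝓧 𝓦)) [IsFiniteMeasure P] (a : Fin 2) :
    Measurable (outcomeReg P a) :=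
  (measurable_uncurry_outcomeReg P).comp measurable_prodMk_left

@[fun_prop]
lemma measurable_propensity (P : Measure (Obs 𝓧 𝓦)) [IsFiniteMeasure P] :
    Measurable (propensity P) :=
  (Kernel.measurable_coe _ (measurableSet_singleton 1)).ennreal_toReal

/-- The parameter will be the training sample; joint measurability is what Fubini over training and
held-out blocks requires. -/
lemma measurable_score_param {T : Type*} [MeasurableSpace T]
    {q : T → Fin 2 → 𝓦 × 𝓧 → ℝ} {γ : T → 𝓦 × 𝓧 → ℝ}
    (hq : ∀ a, Measurable fun p : T × (𝓦 × 𝓧) => q p.1 a p.2)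
    (hγ : Measurable fun p : T × (𝓦 × 𝓧) => γ p.1 p.2) :
    Measurable fun p : T × Obs 𝓧 𝓦 => score (q p.1) (γ p.1) p.2 := by
  have hc : Measurable fun p : T × Obs 𝓧 𝓦 => (p.1, covs p.2) := by fun_prop
  have h1 := (hq 1).comp hc
  have h0 := (hq 0).comp hc
  have hg := hγ.comp hc
  simp only [Function.comp_def] at h1 h0 hg
  have i1 : Measurable fun p : T × Obs 𝓧 𝓦 => (if expo p.2 = 1 then (1 : ℝ) else 0) :=
    (measurable_indicator_expo 1).comp measurable_snd
  have i0 : Measurable fun p : T × Obs 𝓧 𝓦 => (if expo p.2 = 0 then (1 : ℝ) else 0) :=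
    (measurable_indicator_expo 0).comp measurable_snd
  unfold score
  fun_prop

lemma measurable_score {q : Fin 2 → 𝓦 × 𝓧 → ℝ} {γ : 𝓦 × 𝓧 → ℝ}
    (hq : ∀ a, Measurable (q a)) (hγ : Measurable γ) :
    Measurable fun o : Obs 𝓧 𝓦 => score q γ o := by
  have h1 := hq 1
  have h0 := hq 0
  unfold score
  fun_prop

end Measurability

/-! ### Residual orthogonality and the algebraic decomposition of the score -/

section Residual

variable {𝓧 𝓦 : Type*} [MeasurableSpace 𝓧] [MeasurableSpace 𝓦]

/-- The outcome residual `Y - Q(A, W, X)`. -/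
noncomputable def residual (P : Measure (Obs 𝓧 𝓦)) [IsFiniteMeasure P] (o : Obs 𝓧 𝓦) : ℝ :=
  outcome o - outcomeReg P (expo o) (covs o)

/-- The inverse-probability weight `1{A=1}/γ - 1{A=0}/(1-γ)`. -/
noncomputable def weight (γ : 𝓦 × 𝓧 → ℝ) (a : Fin 2) (wx : 𝓦 × 𝓧) : ℝ :=
  (if a = 1 then 1 else 0) / γ wx - (if a = 0 then 1 else 0) / (1 - γ wx)

variable (P : Measure (Obs 𝓧 𝓦)) [IsProbabilityMeasure P]

@[fun_prop]
lemma measurable_residual : Measurable (residual P) := by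
  have := (measurable_uncurry_outcomeReg P).comp
    (measurable_expo.prodMk measurable_covs : Measurable fun o : Obs 𝓧 𝓦 => (expo o, covs o))
  simp only [Function.comp_def] at this
  unfold residual
  fun_prop

lemma measurable_weight {γ : 𝓦 × 𝓧 → ℝ} (hγ : Measurable γ) :
    Measurable fun p : Fin 2 × (𝓦 × 𝓧) => weight γ p.1 p.2 := by
  have i1 : Measurable fun p : Fin 2 × (𝓦 × 𝓧) => (if p.1 = 1 then (1 : ℝ) else 0) :=
    (measurable_of_finite fun b : Fin 2 => if b = 1 then (1 : ℝ) else 0).comp measurable_fst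
  have i0 : Measurable fun p : Fin 2 × (𝓦 × 𝓧) => (if p.1 = 0 then (1 : ℝ) else 0) :=
    (measurable_of_finite fun b : Fin 2 => if b = 0 then (1 : ℝ) else 0).comp measurable_fst
  unfold weight
  fun_prop

/-- The exposure has two values, so the sum of the absolute regressions of both arms is a
square-integrable dominating function. -/
lemma memLp_outcomeReg_expo
    (hQ : ∀ a : Fin 2, MemLp (fun o => outcomeReg P a (covs o)) 2 P) :
    MemLp (fun o => outcomeReg P (expo o) (covs o)) 2 P := by
  have hm : Measurable fun o : Obs 𝓧 𝓦 => outcomeReg P (expo o) (covs o) :=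
    (measurable_uncurry_outcomeReg P).comp
    (measurable_expo.prodMk measurable_covs : Measurable fun o : Obs 𝓧 𝓦 => (expo o, covs o))
  refine ((hQ 0).norm.add (hQ 1).norm).mono hm.aestronglyMeasurable (ae_of_all _ fun o => ?_)
  simp only [Pi.add_apply, Real.norm_eq_abs]
  rw [abs_of_nonneg (a := |outcomeReg P 0 (covs o)| + |outcomeReg P 1 (covs o)|) (by positivity)]
  rcases (by omega : expo o = 0 ∨ expo o = 1) with h | h <;> rw [h]
  · linarith [abs_nonneg (outcomeReg P 1 (covs o))]
  · linarith [abs_nonneg (outcomeReg P 0 (covs o))]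

lemma memLp_residual (hY : MemLp (outcome : Obs 𝓧 𝓦 → ℝ) 2 P)
    (hQ : ∀ a : Fin 2, MemLp (fun o => outcomeReg P a (covs o)) 2 P) :
    MemLp (residual P) 2 P :=
  hY.sub (memLp_outcomeReg_expo P hQ)

/-- Bounded functions of `(A, W, X)` are orthogonal to the residual. -/
lemma integral_mul_residual (hY : MemLp (outcome : Obs 𝓧 𝓦 → ℝ) 2 P)
    (hQ : ∀ a : Fin 2, MemLp (fun o => outcomeReg P a (covs o)) 2 P)
    {F : Fin 2 → 𝓦 × 𝓧 → ℝ} (hF : Measurable fun p : Fin 2 × (𝓦 × 𝓧) => F p.1 p.2)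
    {C : ℝ} (hC : ∀ᵐ o ∂P, |F (expo o) (covs o)| ≤ C) :
    ∫ o, F (expo o) (covs o) * residual P o ∂P = 0 := by
  have hX : Measurable fun o : Obs 𝓧 𝓦 => (expo o, covs o) :=
    measurable_expo.prodMk measurable_covs
  have hFm : AEStronglyMeasurable (fun o : Obs 𝓧 𝓦 => F (expo o) (covs o)) P :=
    (hF.comp hX).aestronglyMeasurable
  have hYi : Integrable (fun o => F (expo o) (covs o) * outcome o) P :=
    (hY.integrable one_le_two).bdd_mul hFm hC
  have hQi : Integrable (fun o => F (expo o) (covs o) * outcomeReg P (expo o) (covs o)) P :=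
    ((memLp_outcomeReg_expo P hQ).integrable one_le_two).bdd_mul hFm hC
  have key := condExp_prod_ae_eq_integral_condDistrib (μ := P) (X := fun o : Obs 𝓧 𝓦 =>
    (expo o, covs o)) (Y := (outcome : Obs 𝓧 𝓦 → ℝ)) hX measurable_outcome.aemeasurable
    (f := fun p => F p.1.1 p.1.2 * p.2)
    ((hF.comp measurable_fst).mul measurable_snd).stronglyMeasurable hYi
  have h1 : ∫ o, F (expo o) (covs o) * outcome o ∂P
      = ∫ o, F (expo o) (covs o) * outcomeReg P (expo o) (covs o) ∂P := by
    rw [← integral_condExp hX.comap_le, integral_congr_ae key]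
    refine integral_congr_ae (ae_of_all _ fun o => ?_)
    exact integral_const_mul (F (expo o) (covs o)) _
  simp only [residual, mul_sub]
  rw [integral_sub hYi hQi, h1, sub_self]

/-- The propensity is the conditional mean of `1{A = 1}`. -/
lemma integral_indicator_expo_mul {f : 𝓦 × 𝓧 → ℝ} (hf : Measurable f)
    (hfi : Integrable (fun o => f (covs o)) P) :
    ∫ o, (if expo o = 1 then 1 else 0) * f (covs o) ∂P
      = ∫ o, propensity P (covs o) * f (covs o) ∂P := by
  have hi : Integrable (fun o => (if expo o = 1 then (1 : ℝ) else 0) * f (covs o)) P :=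
    hfi.bdd_mul (c := 1) (by fun_prop) (ae_of_all _ fun o => by split_ifs <;> simp)
  have hm : Measurable fun b : Fin 2 => if b = 1 then (1 : ℝ) else 0 := measurable_of_finite _
  have key := condExp_prod_ae_eq_integral_condDistrib (μ := P) (X := (covs : Obs 𝓧 𝓦 → _))
    (Y := (expo : Obs 𝓧 𝓦 → _)) measurable_covs measurable_expo.aemeasurable
    (f := fun p => (if p.2 = 1 then (1 : ℝ) else 0) * f p.1)
    ((hm.comp measurable_snd).mul (hf.comp measurable_fst)).stronglyMeasurable hi
  rw [← integral_condExp measurable_covs.comap_le, integral_congr_ae key]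
  refine integral_congr_ae (ae_of_all _ fun o => ?_)
  have : (fun b : Fin 2 => if b = 1 then (1 : ℝ) else 0) = Set.indicator {1} 1 := by
    ext b; simp [Set.indicator]
  simp only [integral_mul_const, propensity]
  rw [this, integral_indicator_one (measurableSet_singleton _)]

lemma propensity_nonneg (wx : 𝓦 × 𝓧) : 0 ≤ propensity P wx := measureReal_nonneg

lemma propensity_le_one (wx : 𝓦 × 𝓧) : propensity P wx ≤ 1 := measureReal_le_one

/-- This isolates the residual, with a weight depending only on `γ`, from the outcome errors, which
vanish at `q = Q`. The identity is pointwise and needs no positivity, since each reciprocal is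
carried along as a common factor. -/
lemma score_eq (q : Fin 2 → 𝓦 × 𝓧 → ℝ) (γ : 𝓦 × 𝓧 → ℝ) (o : Obs 𝓧 𝓦) :
    score q γ o = weight γ (expo o) (covs o) * residual P o
      + (1 - (if expo o = 1 then 1 else 0) / γ (covs o)) * (q 1 (covs o) - outcomeReg P 1 (covs o))
      - (1 - (if expo o = 0 then 1 else 0) / (1 - γ (covs o)))
        * (q 0 (covs o) - outcomeReg P 0 (covs o))
      + contrast P (covs o) := by
  rcases (by omega : expo o = 0 ∨ expo o = 1) with h | h <;>
  · simp only [score, weight, residual, contrast, h]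
    simp
    ring

end Residual

/-! ### Bounds on inverse-probability weights and Cauchy–Schwarz -/

section Bounds

variable {𝓧 𝓦 : Type*}

lemma abs_weight_le {γ : 𝓦 × 𝓧 → ℝ} {ε : ℝ} (hε : 0 < ε) {a : Fin 2} {wx : 𝓦 × 𝓧}
    (h : ε ≤ γ wx ∧ γ wx ≤ 1 - ε) : |weight γ a wx| ≤ 1 / ε := by
  have h1 : 0 < γ wx := hε.trans_le h.1
  have h2 : 0 < 1 - γ wx := by linarith [h.2]
  rcases (by omega : a = 0 ∨ a = 1) with ha | ha
  · simp only [weight, ha]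
    simp only [Fin.isValue, zero_ne_one, if_false, zero_div, if_true, zero_sub, abs_neg]
    rw [abs_of_pos (by positivity)]
    exact one_div_le_one_div_of_le hε (by linarith [h.2])
  · simp only [weight, ha]
    simp only [Fin.isValue, one_ne_zero, if_false, zero_div, if_true, sub_zero]
    rw [abs_of_pos (by positivity)]
    exact one_div_le_one_div_of_le hε h.1

/-- Inversion is Lipschitz away from zero. Both arms give the same bound because `1 - γ` and `1 - g`
differ by `γ - g` up to sign. -/
lemma abs_weight_sub_weight_le {γ g : 𝓦 × 𝓧 → ℝ} {ε ε₀ : ℝ} (hε : 0 < ε) (hε₀ : 0 < ε₀)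
    {a : Fin 2} {wx : 𝓦 × 𝓧} (h : ε ≤ γ wx ∧ γ wx ≤ 1 - ε) (h₀ : ε₀ ≤ g wx ∧ g wx ≤ 1 - ε₀) :
    |weight γ a wx - weight g a wx| ≤ 1 / (ε * ε₀) * |γ wx - g wx| := by
  have h1 : 0 < γ wx := hε.trans_le h.1
  have h2 : 0 < 1 - γ wx := by linarith [h.2]
  have h3 : 0 < g wx := hε₀.trans_le h₀.1
  have h4 : 0 < 1 - g wx := by linarith [h₀.2]
  rcases (by omega : a = 0 ∨ a = 1) with ha | ha
  · simp only [weight, ha]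
    simp only [Fin.isValue, zero_ne_one, if_false, zero_div, if_true, zero_sub]
    have : -(1 / (1 - γ wx)) - -(1 / (1 - g wx))
        = -(1 / ((1 - γ wx) * (1 - g wx)) * (γ wx - g wx)) := by
      field_simp; ring
    rw [this, abs_neg, abs_mul, abs_of_pos (by positivity)]
    gcongr
    · linarith [h.2]
    · linarith [h₀.2]
  · simp only [weight, ha]
    simp only [Fin.isValue, one_ne_zero, if_false, zero_div, if_true, sub_zero]
    have : 1 / γ wx - 1 / g wx = -(1 / (γ wx * g wx) * (γ wx - g wx)) := by
      field_simp; ring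
    rw [this, abs_neg, abs_mul, abs_of_pos (by positivity)]
    gcongr
    · exact h.1
    · exact h₀.1

lemma eLpNorm_const_mul_eq {α : Type*} [MeasurableSpace α] {μ : Measure α} {c : ℝ} (hc : 0 ≤ c)
    (f : α → ℝ) (p : ℝ≥0∞) : eLpNorm (fun x => c * f x) p μ = c.toNNReal * eLpNorm f p μ := by
  have := eLpNorm_const_smul c f p μ
  rw [← ofReal_norm, Real.norm_of_nonneg hc] at this
  exact this

lemma eLpNorm_abs_eq {α : Type*} [MeasurableSpace α] {μ : Measure α} (f : α → ℝ) (p : ℝ≥0∞) :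
    eLpNorm (fun x => |f x|) p μ = eLpNorm f p μ :=
  eLpNorm_norm f

/-- Cauchy–Schwarz for a product with a bounded factor. -/
lemma enorm_integral_mul_le {α : Type*} [MeasurableSpace α] {μ : Measure α} {f g h : α → ℝ}
    {C : ℝ≥0} (hf : AEStronglyMeasurable f μ)
    (hg : AEStronglyMeasurable g μ) (hh : ∀ᵐ o ∂μ, ‖h o‖ ≤ C * ‖g o‖) :
    ‖∫ o, f o * h o ∂μ‖ₑ ≤ C * (eLpNorm f 2 μ * eLpNorm g 2 μ) := by
  calc ‖∫ o, f o * h o ∂μ‖ₑ ≤ ∫⁻ o, ‖f o * h o‖ₑ ∂μ := enorm_integral_le_lintegral_enorm _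
    _ ≤ ∫⁻ o, C * ‖f o * g o‖ₑ ∂μ := by
      refine lintegral_mono_ae ?_
      filter_upwards [hh] with o ho
      have : ‖h o‖ₑ ≤ C * ‖g o‖ₑ := by
        rw [← ofReal_norm, ← ofReal_norm, ← ENNReal.ofReal_coe_nnreal,
          ← ENNReal.ofReal_mul C.coe_nonneg]
        exact ENNReal.ofReal_le_ofReal ho
      rw [enorm_mul, enorm_mul]
      calc _ ≤ ‖f o‖ₑ * (C * ‖g o‖ₑ) := by gcongr
        _ = _ := by ring
    _ = C * eLpNorm (f • g) 1 μ := by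
      rw [lintegral_const_mul' _ _ ENNReal.coe_ne_top, eLpNorm_one_eq_lintegral_enorm]
      rfl
    _ ≤ _ := by
      gcongr
      exact eLpNorm_smul_le_mul_eLpNorm hg hf

end Bounds

/-! ### The second-order bias of the score -/

section Bias

variable {𝓧 𝓦 : Type*} [MeasurableSpace 𝓧] [MeasurableSpace 𝓦]
variable (P : Measure (Obs 𝓧 𝓦)) [IsProbabilityMeasure P]

/-- The mean of the score, with its second-order bias. -/
lemma integral_score (hY : MemLp (outcome : Obs 𝓧 𝓦 → ℝ) 2 P)
    (hQ : ∀ a : Fin 2, MemLp (fun o => outcomeReg P a (covs o)) 2 P)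
    {q : Fin 2 → 𝓦 × 𝓧 → ℝ} {γ : 𝓦 × 𝓧 → ℝ} (hq : ∀ a, Measurable (q a)) (hγ : Measurable γ)
    {ε : ℝ} (hε : 0 < ε) (hb : ∀ᵐ o ∂P, ε ≤ γ (covs o) ∧ γ (covs o) ≤ 1 - ε)
    (hd : ∀ a, MemLp (fun o => q a (covs o) - outcomeReg P a (covs o)) 2 P) :
    Integrable (score q γ) P ∧
    ∫ o, score q γ o ∂P = psi P
      + ∫ o, (γ (covs o) - propensity P (covs o)) *
          ((q 1 (covs o) - outcomeReg P 1 (covs o)) / γ (covs o)) ∂P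
      + ∫ o, (γ (covs o) - propensity P (covs o)) *
          ((q 0 (covs o) - outcomeReg P 0 (covs o)) / (1 - γ (covs o))) ∂P := by
  have i1 : Integrable (fun o => weight γ (expo o) (covs o) * residual P o) P := by
    refine ((memLp_residual P hY hQ).integrable one_le_two).bdd_mul (c := 1 / ε) ?_ ?_
    · exact ((measurable_weight hγ).comp (measurable_expo.prodMk measurable_covs :
        Measurable fun o : Obs 𝓧 𝓦 => (expo o, covs o))).aestronglyMeasurable
    · filter_upwards [hb] with o ho using abs_weight_le hε ho
  have z1 : ∫ o, weight γ (expo o) (covs o) * residual P o ∂P = 0 := by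
    refine integral_mul_residual P hY hQ (measurable_weight hγ) (C := 1 / ε) ?_
    filter_upwards [hb] with o ho using abs_weight_le hε ho
  have d1 := (hd 1).integrable one_le_two
  have d0 := (hd 0).integrable one_le_two
  have mQ := measurable_outcomeReg P
  have e1 : Integrable (fun o => (q 1 (covs o) - outcomeReg P 1 (covs o)) / γ (covs o)) P := by
    simp only [div_eq_inv_mul]
    refine d1.bdd_mul (c := 1 / ε) (Measurable.aestronglyMeasurable (by fun_prop)) ?_
    filter_upwards [hb] with o ho
    have h1 : 0 < γ (covs o) := hε.trans_le ho.1
    rw [Real.norm_of_nonneg (by positivity), ← one_div]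
    exact one_div_le_one_div_of_le hε ho.1
  have e0 : Integrable
      (fun o => (q 0 (covs o) - outcomeReg P 0 (covs o)) / (1 - γ (covs o))) P := by
    simp only [div_eq_inv_mul]
    refine d0.bdd_mul (c := 1 / ε) (Measurable.aestronglyMeasurable (by fun_prop)) ?_
    filter_upwards [hb] with o ho
    have h1 : 0 < 1 - γ (covs o) := by linarith [ho.2]
    rw [Real.norm_of_nonneg (by positivity), ← one_div]
    exact one_div_le_one_div_of_le hε (by linarith [ho.2])
  have hA {f : Obs 𝓧 𝓦 → ℝ} (hf : Integrable f P) :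
      Integrable (fun o => (if expo o = 1 then (1 : ℝ) else 0) * f o) P :=
    hf.bdd_mul (c := 1) (by fun_prop) (ae_of_all _ fun o => by split_ifs <;> simp)
  have hγi {f : Obs 𝓧 𝓦 → ℝ} (hf : Integrable f P) :
      Integrable (fun o => γ (covs o) * f o) P := by
    refine hf.bdd_mul (c := 1) (hγ.comp measurable_covs).aestronglyMeasurable ?_
    filter_upwards [hb] with o ho
    rw [Real.norm_of_nonneg (by linarith [ho.1])]
    linarith [ho.2]
  have hgi {f : Obs 𝓧 𝓦 → ℝ} (hf : Integrable f P) :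
      Integrable (fun o => propensity P (covs o) * f o) P := by
    refine hf.bdd_mul (c := 1)
      ((measurable_propensity P).comp measurable_covs).aestronglyMeasurable
      (ae_of_all _ fun o => ?_)
    rw [Real.norm_of_nonneg (propensity_nonneg P _)]
    exact propensity_le_one P _
  have p1 := integral_indicator_expo_mul P
    (f := fun wx => (q 1 wx - outcomeReg P 1 wx) / γ wx) (by fun_prop) e1
  have p0 := integral_indicator_expo_mul P
    (f := fun wx => (q 0 wx - outcomeReg P 0 wx) / (1 - γ wx)) (by fun_prop) e0
  have ic : Integrable (fun o => contrast P (covs o)) P :=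
    ((hQ 1).sub (hQ 0)).integrable one_le_two
  -- Using 1{A=0} = 1 - 1{A=1}, both arms acquire the same factor γ - 1{A=1}, over γ or over 1 - γ.
  -- One identity for the conditional mean of 1{A=1} then treats both.
  have hs : score q γ =ᵐ[P] fun o => weight γ (expo o) (covs o) * residual P o
      + (γ (covs o) * ((q 1 (covs o) - outcomeReg P 1 (covs o)) / γ (covs o))
        - (if expo o = 1 then 1 else 0) * ((q 1 (covs o) - outcomeReg P 1 (covs o)) / γ (covs o)))
      + (γ (covs o) * ((q 0 (covs o) - outcomeReg P 0 (covs o)) / (1 - γ (covs o)))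
        - (if expo o = 1 then 1 else 0)
          * ((q 0 (covs o) - outcomeReg P 0 (covs o)) / (1 - γ (covs o))))
      + contrast P (covs o) := by
    filter_upwards [hb] with o ho
    have h1 : γ (covs o) ≠ 0 := (hε.trans_le ho.1).ne'
    have h2 : 1 - γ (covs o) ≠ 0 := by
      have : 0 < 1 - γ (covs o) := by linarith [ho.2]
      exact this.ne'
    rw [score_eq P]
    rcases (by omega : expo o = 0 ∨ expo o = 1) with h | h <;>
    · simp only [h]
      simp only [Fin.isValue, zero_ne_one, one_ne_zero, if_false, if_true]
      field_simp
      ring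
  refine ⟨(integrable_congr hs).2
    (((i1.add ((hγi e1).sub (hA e1))).add ((hγi e0).sub (hA e0))).add ic), ?_⟩
  have hsum {f₁ f₂ f₃ f₄ f₅ f₆ : Obs 𝓧 𝓦 → ℝ} (h₁ : Integrable f₁ P) (h₂ : Integrable f₂ P)
      (h₃ : Integrable f₃ P) (h₄ : Integrable f₄ P) (h₅ : Integrable f₅ P)
      (h₆ : Integrable f₆ P) :
      ∫ o, f₁ o + (f₂ o - f₃ o) + (f₄ o - f₅ o) + f₆ o ∂P = ∫ o, f₁ o ∂P
        + (∫ o, f₂ o ∂P - ∫ o, f₃ o ∂P) + (∫ o, f₄ o ∂P - ∫ o, f₅ o ∂P) + ∫ o, f₆ o ∂P := by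
    change ∫ o, (f₁ + (f₂ - f₃) + (f₄ - f₅) + f₆) o ∂P = _
    rw [integral_add' ((h₁.add (h₂.sub h₃)).add (h₄.sub h₅)) h₆,
      integral_add' (h₁.add (h₂.sub h₃)) (h₄.sub h₅), integral_add' h₁ (h₂.sub h₃),
      integral_sub' h₂ h₃, integral_sub' h₄ h₅]
  rw [integral_congr_ae hs, hsum i1 (hγi e1) (hA e1) (hγi e0) (hA e0) ic, z1, p1, p0, psi]
  simp only [sub_mul]
  rw [integral_sub (hγi e1) (hgi e1), integral_sub (hγi e0) (hgi e0)]
  ring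

end Bias

/-- The difference between a score and the score at the true nuisances. -/
noncomputable def scoreError {𝓧 𝓦 : Type*} [MeasurableSpace 𝓧] [MeasurableSpace 𝓦]
    (P : Measure (Obs 𝓧 𝓦)) [IsFiniteMeasure P]
    (q : Fin 2 → 𝓦 × 𝓧 → ℝ) (γ : 𝓦 × 𝓧 → ℝ) (o : Obs 𝓧 𝓦) : ℝ :=
  score q γ o - score (outcomeReg P) (propensity P) o

/-! ### Mean and `L₂` size of the score error; moments of the influence function -/

section ScoreError

variable {𝓧 𝓦 : Type*} [MeasurableSpace 𝓧] [MeasurableSpace 𝓦]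
variable (P : Measure (Obs 𝓧 𝓦)) [IsProbabilityMeasure P]

/-- At the true nuisances both bias integrals vanish. -/
lemma integral_true_score (hY : MemLp (outcome : Obs 𝓧 𝓦 → ℝ) 2 P)
    (hQ : ∀ a : Fin 2, MemLp (fun o => outcomeReg P a (covs o)) 2 P)
    {ε₀ : ℝ} (hε₀ : 0 < ε₀)
    (hg₀ : ∀ᵐ o ∂P, ε₀ ≤ propensity P (covs o) ∧ propensity P (covs o) ≤ 1 - ε₀) :
    Integrable (score (outcomeReg P) (propensity P)) P ∧
    ∫ o, score (outcomeReg P) (propensity P) o ∂P = psi P := by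
  have := integral_score P hY hQ (measurable_outcomeReg P) (measurable_propensity P) hε₀ hg₀
    (by simp)
  simpa using this

/-- The bias of the score is second order. -/
lemma enorm_integral_scoreError_le (hY : MemLp (outcome : Obs 𝓧 𝓦 → ℝ) 2 P)
    (hQ : ∀ a : Fin 2, MemLp (fun o => outcomeReg P a (covs o)) 2 P)
    {ε₀ : ℝ} (hε₀ : 0 < ε₀)
    (hg₀ : ∀ᵐ o ∂P, ε₀ ≤ propensity P (covs o) ∧ propensity P (covs o) ≤ 1 - ε₀)
    {q : Fin 2 → 𝓦 × 𝓧 → ℝ} {γ : 𝓦 × 𝓧 → ℝ} (hq : ∀ a, Measurable (q a)) (hγ : Measurable γ)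
    {ε : ℝ} (hε : 0 < ε) (hb : ∀ wx, ε ≤ γ wx ∧ γ wx ≤ 1 - ε)
    (hfin : ∑ a, l2norm P (fun wx => q a wx - outcomeReg P a wx) ≠ ∞) :
    ‖∫ o, scoreError P q γ o ∂P‖ₑ ≤ (1 / ε).toNNReal *
      (l2norm P (fun wx => γ wx - propensity P wx) *
        ∑ a, l2norm P (fun wx => q a wx - outcomeReg P a wx)) := by
  have mQ := measurable_outcomeReg P
  have hd : ∀ a, MemLp (fun o => q a (covs o) - outcomeReg P a (covs o)) 2 P := fun a =>
    ⟨by fun_prop, (ENNReal.lt_top_of_sum_ne_top hfin (Finset.mem_univ a))⟩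
  obtain ⟨i1, h1⟩ := integral_score P hY hQ hq hγ hε (ae_of_all _ fun o => hb (covs o)) hd
  obtain ⟨i2, h2⟩ := integral_true_score P hY hQ hε₀ hg₀
  simp only [scoreError]
  rw [integral_sub i1 i2, h1, h2, add_assoc, add_sub_cancel_left, Fin.sum_univ_two, mul_add,
    mul_add, add_comm]
  have hC : (((1 / ε).toNNReal : ℝ≥0) : ℝ) = 1 / ε := Real.coe_toNNReal _ (by positivity)
  refine (enorm_add_le _ _).trans (add_le_add ?_ ?_)
  · refine enorm_integral_mul_le (g := fun o => q 0 (covs o) - outcomeReg P 0 (covs o))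
      (by fun_prop) (by fun_prop) (ae_of_all _ fun o => ?_)
    have := hb (covs o)
    have h3 : 0 < 1 - γ (covs o) := by linarith
    rw [hC, norm_div, Real.norm_of_nonneg h3.le, div_eq_inv_mul, ← one_div]
    gcongr
    linarith
  · refine enorm_integral_mul_le (g := fun o => q 1 (covs o) - outcomeReg P 1 (covs o))
      (by fun_prop) (by fun_prop) (ae_of_all _ fun o => ?_)
    have := hb (covs o)
    have h3 : 0 < γ (covs o) := by linarith
    rw [hC, norm_div, Real.norm_of_nonneg h3.le, div_eq_inv_mul, ← one_div]
    gcongr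
    linarith

/-- Subtract the decompositions of the two scores: the contrast cancels, the outcome errors of the
true score are zero, and the weights differ by a multiple of the propensity error. -/
lemma ae_abs_scoreError_le {ε₀ : ℝ} (hε₀ : 0 < ε₀)
    (hg₀ : ∀ᵐ o ∂P, ε₀ ≤ propensity P (covs o) ∧ propensity P (covs o) ≤ 1 - ε₀)
    {q : Fin 2 → 𝓦 × 𝓧 → ℝ} {γ : 𝓦 × 𝓧 → ℝ}
    {ε : ℝ} (hε : 0 < ε) (hb : ∀ wx, ε ≤ γ wx ∧ γ wx ≤ 1 - ε) :
    ∀ᵐ o ∂P, |scoreError P q γ o| ≤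
      1 / (ε * ε₀) * |(γ (covs o) - propensity P (covs o)) * residual P o|
      + (1 + 1 / ε) * ∑ a, |q a (covs o) - outcomeReg P a (covs o)| := by
  filter_upwards [hg₀] with o ho
  have hbo := hb (covs o)
  have hw := abs_weight_sub_weight_le hε hε₀ (a := expo o) hbo ho
  have hm (a : Fin 2) {x : ℝ} (hx : ε ≤ x) :
      |1 - (if expo o = a then 1 else 0) / x| ≤ 1 + 1 / ε := by
    have hx0 : 0 < x := hε.trans_le hx
    refine (abs_sub _ _).trans ?_
    rw [abs_one, abs_div, abs_of_pos hx0]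
    gcongr
    split_ifs <;> simp
  have e : scoreError P q γ o =
      (weight γ (expo o) (covs o) - weight (propensity P) (expo o) (covs o)) * residual P o
      + (1 - (if expo o = 1 then 1 else 0) / γ (covs o)) * (q 1 (covs o) - outcomeReg P 1 (covs o))
      - (1 - (if expo o = 0 then 1 else 0) / (1 - γ (covs o)))
        * (q 0 (covs o) - outcomeReg P 0 (covs o)) := by
    rw [scoreError, score_eq P, score_eq P]
    ring
  rw [e, Fin.sum_univ_two]
  refine (abs_sub _ _).trans ((add_le_add_left (abs_add_le _ _) _).trans ?_)
  rw [abs_mul, abs_mul, abs_mul, abs_mul, ← mul_assoc, add_assoc, mul_add]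
  refine add_le_add (by gcongr) ?_
  rw [add_comm]
  refine add_le_add ?_ ?_
  · gcongr; exact hm 0 (by linarith)
  · gcongr; exact hm 1 hbo.1

/-- The product of propensity error and residual is left intact because it is estimated in two ways
later: by the residual alone, and by truncation when the propensity error is small. -/
lemma eLpNorm_scoreError_le {ε₀ : ℝ} (hε₀ : 0 < ε₀)
    (hg₀ : ∀ᵐ o ∂P, ε₀ ≤ propensity P (covs o) ∧ propensity P (covs o) ≤ 1 - ε₀)
    {q : Fin 2 → 𝓦 × 𝓧 → ℝ} {γ : 𝓦 × 𝓧 → ℝ} (hq : ∀ a, Measurable (q a)) (hγ : Measurable γ)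
    {ε : ℝ} (hε : 0 < ε) (hb : ∀ wx, ε ≤ γ wx ∧ γ wx ≤ 1 - ε) :
    eLpNorm (scoreError P q γ) 2 P ≤ (1 / (ε * ε₀)).toNNReal *
        eLpNorm (fun o => (γ (covs o) - propensity P (covs o)) * residual P o) 2 P
      + (1 + 1 / ε).toNNReal * ∑ a, l2norm P (fun wx => q a wx - outcomeReg P a wx) := by
  have mQ := measurable_outcomeReg P
  have mr := measurable_residual P
  refine (eLpNorm_mono_ae_real (ae_abs_scoreError_le P hε₀ hg₀ hε hb)).trans ?_
  refine (eLpNorm_add_le (by fun_prop) (by fun_prop) one_le_two).trans ?_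
  have e1 : eLpNorm (fun o => 1 / (ε * ε₀) *
      |(γ (covs o) - propensity P (covs o)) * residual P o|) 2 P ≤ (1 / (ε * ε₀)).toNNReal *
        eLpNorm (fun o => (γ (covs o) - propensity P (covs o)) * residual P o) 2 P := by
    rw [eLpNorm_const_mul_eq (by positivity), eLpNorm_abs_eq]
  have e2 : eLpNorm (fun o => (1 + 1 / ε) *
      ∑ a, |q a (covs o) - outcomeReg P a (covs o)|) 2 P ≤ (1 + 1 / ε).toNNReal *
      ∑ a, l2norm P (fun wx => q a wx - outcomeReg P a wx) := by
    have e3 : eLpNorm (fun o => ∑ a, |q a (covs o) - outcomeReg P a (covs o)|) 2 P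
        ≤ ∑ a, l2norm P (fun wx => q a wx - outcomeReg P a wx) := by
      rw [Fin.sum_univ_two]
      simp only [Fin.sum_univ_two]
      refine (eLpNorm_add_le (by fun_prop) (by fun_prop) one_le_two).trans (add_le_add ?_ ?_)
      · exact (eLpNorm_abs_eq _ _).le
      · exact (eLpNorm_abs_eq _ _).le
    rw [eLpNorm_const_mul_eq (by positivity)]
    gcongr
  exact add_le_add e1 e2

lemma abs_sub_propensity_le_one {γ : 𝓦 × 𝓧 → ℝ} {ε : ℝ} (hε : 0 < ε)
    (hb : ∀ wx, ε ≤ γ wx ∧ γ wx ≤ 1 - ε) (wx : 𝓦 × 𝓧) : |γ wx - propensity P wx| ≤ 1 := by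
  rw [abs_le]
  constructor <;> linarith [hb wx, propensity_nonneg P wx, propensity_le_one P wx]

/-- Scores with bounded outcome error are bounded in `L₂`. -/
lemma eLpNorm_scoreError_le_of_bounded {ε₀ : ℝ} (hε₀ : 0 < ε₀)
    (hg₀ : ∀ᵐ o ∂P, ε₀ ≤ propensity P (covs o) ∧ propensity P (covs o) ≤ 1 - ε₀)
    {q : Fin 2 → 𝓦 × 𝓧 → ℝ} {γ : 𝓦 × 𝓧 → ℝ} (hq : ∀ a, Measurable (q a)) (hγ : Measurable γ)
    {ε : ℝ} (hε : 0 < ε) (hb : ∀ wx, ε ≤ γ wx ∧ γ wx ≤ 1 - ε) :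
    eLpNorm (scoreError P q γ) 2 P ≤ (1 / (ε * ε₀)).toNNReal * eLpNorm (residual P) 2 P
      + (1 + 1 / ε).toNNReal * ∑ a, l2norm P (fun wx => q a wx - outcomeReg P a wx) := by
  refine (eLpNorm_scoreError_le P hε₀ hg₀ hq hγ hε hb).trans ?_
  gcongr
  refine eLpNorm_mono fun o => ?_
  rw [norm_mul]
  exact mul_le_of_le_one_left (norm_nonneg _) (abs_sub_propensity_le_one P hε hb (covs o))

/-- The score is `L₂`-continuous in the nuisances at the truth. -/
lemma exists_eLpNorm_scoreError_le (hY : MemLp (outcome : Obs 𝓧 𝓦 → ℝ) 2 P)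
    (hQ : ∀ a : Fin 2, MemLp (fun o => outcomeReg P a (covs o)) 2 P)
    {ε₀ : ℝ} (hε₀ : 0 < ε₀)
    (hg₀ : ∀ᵐ o ∂P, ε₀ ≤ propensity P (covs o) ∧ propensity P (covs o) ≤ 1 - ε₀)
    {ε : ℝ} (hε : 0 < ε) {v : ℝ≥0} (hv : 0 < v) :
    ∃ δ : ℝ≥0, 0 < δ ∧ ∀ (q : Fin 2 → 𝓦 × 𝓧 → ℝ) (γ : 𝓦 × 𝓧 → ℝ), (∀ a, Measurable (q a)) →
      Measurable γ → (∀ wx, ε ≤ γ wx ∧ γ wx ≤ 1 - ε) →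
      ∑ a, l2norm P (fun wx => q a wx - outcomeReg P a wx) ≤ δ →
      l2norm P (fun wx => γ wx - propensity P wx) ≤ δ →
      eLpNorm (scoreError P q γ) 2 P ≤ v := by
  have mr := measurable_residual P
  set C₁ : ℝ≥0 := (1 / (ε * ε₀)).toNNReal
  set C₂ : ℝ≥0 := (1 + 1 / ε).toNNReal
  -- Half of `v` is allotted to the tail of the residual, which is later multiplied by `C₁`; the
  -- added 1 keeps the denominator positive.
  have hv' : (0 : ℝ) < v / (2 * (C₁ + 1)) := by positivity
  obtain ⟨M, hM0, hM⟩ := (memLp_residual P hY hQ).eLpNorm_indicator_norm_ge_pos_le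
    mr.stronglyMeasurable hv'
  set M' : ℝ≥0 := M.toNNReal
  have hM' : (M' : ℝ) = M := Real.coe_toNNReal _ hM0.le
  -- With this `δ`, the terms linear in the nuisance errors total `(C₁ * M' + C₂) * δ ≤ v / 2`.
  refine ⟨v / (2 * (C₁ * M' + C₂ + 1)), by positivity, fun q γ hq hγ hb h1 h2 => ?_⟩
  have hr : eLpNorm (fun o => (γ (covs o) - propensity P (covs o)) * residual P o) 2 P
      ≤ M' * l2norm P (fun wx => γ wx - propensity P wx) + (v / (2 * (C₁ + 1)) : ℝ≥0) := by
    -- Where the residual is below `M`, bound it by `M` and keep the propensity error; elsewhere,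
    -- bound the propensity error by 1 and keep the residual, whose tail is small in `L₂`.
    have hr1 : ∀ᵐ o ∂P, ‖(γ (covs o) - propensity P (covs o)) * residual P o‖ ≤
        M * |γ (covs o) - propensity P (covs o)|
          + |Set.indicator {x | M ≤ ‖residual P x‖₊} (residual P) o| := ae_of_all _ fun o => by
      have h3 := abs_sub_propensity_le_one P hε hb (covs o)
      rw [norm_mul, Real.norm_eq_abs, Real.norm_eq_abs]
      by_cases ho : M ≤ ‖residual P o‖₊
      · rw [Set.indicator_of_mem (by exact ho)]
        have := mul_le_of_le_one_left (abs_nonneg (residual P o)) h3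
        have : 0 ≤ M * |γ (covs o) - propensity P (covs o)| := by positivity
        linarith
      · rw [Set.indicator_of_notMem (by exact ho), abs_zero, add_zero, mul_comm]
        gcongr
        push Not at ho
        rw [coe_nnnorm, Real.norm_eq_abs] at ho
        exact ho.le
    have hset : MeasurableSet {x | M ≤ ‖residual P x‖₊} :=
      measurableSet_le measurable_const mr.nnnorm.coe_nnreal_real
    have mi : Measurable (Set.indicator {x | M ≤ ‖residual P x‖₊} (residual P)) :=
      mr.indicator hset
    refine (eLpNorm_mono_ae_real hr1).trans
      ((eLpNorm_add_le (by fun_prop) (by fun_prop) one_le_two).trans (add_le_add ?_ ?_))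
    · rw [eLpNorm_const_mul_eq hM0.le, eLpNorm_abs_eq]
      rfl
    · rw [eLpNorm_abs_eq]
      refine hM.trans_eq ?_
      rw [ENNReal.ofReal]
      congr 1
      rw [← NNReal.coe_inj, Real.coe_toNNReal _ hv'.le]
      push_cast
      rfl
  refine (eLpNorm_scoreError_le P hε₀ hg₀ hq hγ hε hb).trans ?_
  calc _ ≤ (C₁ : ℝ≥0∞) * (M' * (v / (2 * (C₁ * M' + C₂ + 1)) : ℝ≥0) + (v / (2 * (C₁ + 1)) : ℝ≥0))
        + C₂ * (v / (2 * (C₁ * M' + C₂ + 1)) : ℝ≥0) := by gcongr; exact hr.trans (by gcongr)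
    _ ≤ v := by
      norm_cast
      rw [← NNReal.coe_le_coe]
      push_cast
      have a1 : (C₁ : ℝ) * (v / (2 * (C₁ + 1))) ≤ v / 2 := by
        rw [mul_div_assoc', div_le_div_iff₀ (by positivity) (by positivity)]
        nlinarith [v.coe_nonneg, C₁.coe_nonneg]
      have a2 : ((C₁ : ℝ) * M' + C₂) * (v / (2 * (C₁ * M' + C₂ + 1))) ≤ v / 2 := by
        rw [mul_div_assoc', div_le_div_iff₀ (by positivity) (by positivity)]
        nlinarith [v.coe_nonneg]
      linarith

/-- In `score_eq` at the truth only a bounded weight times the residual and the contrast survive,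
and both are square-integrable. -/
lemma memLp_influence (hY : MemLp (outcome : Obs 𝓧 𝓦 → ℝ) 2 P)
    (hQ : ∀ a : Fin 2, MemLp (fun o => outcomeReg P a (covs o)) 2 P)
    {ε₀ : ℝ} (hε₀ : 0 < ε₀)
    (hg₀ : ∀ᵐ o ∂P, ε₀ ≤ propensity P (covs o) ∧ propensity P (covs o) ≤ 1 - ε₀) :
    MemLp (influence P) 2 P := by
  have mw : Measurable fun o : Obs 𝓧 𝓦 => weight (propensity P) (expo o) (covs o) :=
    (measurable_weight (measurable_propensity P)).comp (measurable_expo.prodMk measurable_covs :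
        Measurable fun o : Obs 𝓧 𝓦 => (expo o, covs o))
  have h1 : MemLp (fun o => weight (propensity P) (expo o) (covs o) * residual P o) 2 P := by
    refine (memLp_residual P hY hQ).of_le_mul (c := 1 / ε₀)
      (mw.mul (measurable_residual P)).aestronglyMeasurable ?_
    filter_upwards [hg₀] with o ho
    rw [norm_mul]
    gcongr
    exact abs_weight_le hε₀ ho
  have h2 : MemLp (fun o => weight (propensity P) (expo o) (covs o) * residual P o
      + (outcomeReg P 1 (covs o) - outcomeReg P 0 (covs o)) - psi P) 2 P :=
    (h1.add ((hQ 1).sub (hQ 0))).sub (memLp_const _)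
  refine h2.congr_norm ?_ (ae_of_all _ fun o => ?_)
  · exact ((measurable_score (measurable_outcomeReg P) (measurable_propensity P)).sub
      measurable_const).aestronglyMeasurable
  · rw [influence, score_eq P]
    simp [contrast]

lemma integral_influence (hY : MemLp (outcome : Obs 𝓧 𝓦 → ℝ) 2 P)
    (hQ : ∀ a : Fin 2, MemLp (fun o => outcomeReg P a (covs o)) 2 P)
    {ε₀ : ℝ} (hε₀ : 0 < ε₀)
    (hg₀ : ∀ᵐ o ∂P, ε₀ ≤ propensity P (covs o) ∧ propensity P (covs o) ≤ 1 - ε₀) :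
    ∫ o, influence P o ∂P = 0 := by
  obtain ⟨i, h⟩ := integral_true_score P hY hQ hε₀ hg₀
  simp only [influence]
  rw [integral_sub i (integrable_const _), h]
  simp

@[fun_prop]
lemma measurable_influence : Measurable (influence P) :=
  (measurable_score (measurable_outcomeReg P) (measurable_propensity P)).sub measurable_const

end ScoreError

lemma eLpNorm_two_sq {α : Type*} [MeasurableSpace α] (P : Measure α) (f : α → ℝ) :
    eLpNorm f 2 P ^ 2 = ∫⁻ x, ‖f x‖ₑ ^ 2 ∂P := by
  rw [eLpNorm_eq_lintegral_rpow_enorm_toReal two_ne_zero ENNReal.ofNat_ne_top,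
    ← ENNReal.rpow_natCast, ← ENNReal.rpow_mul]
  simp

/-! ### Chebyshev and Markov bounds under product measures -/

section ProductConcentration

variable {E : Type*} [MeasurableSpace E] (P : Measure E) [IsProbabilityMeasure P]

/-- A uniform bound on the sections over one block of coordinates bounds the product measure. -/
lemma measure_pi_le_of_section_le {ι : Type*} [Fintype ι] (p : ι → Prop) [DecidablePred p]
    {A : Set (({i // p i} → E) × ({i // ¬ p i} → E))} (hA : MeasurableSet A) {B : ℝ≥0∞}
    (hB : ∀ t, Measure.pi (fun _ : {i // ¬ p i} => P) (Prod.mk t ⁻¹' A) ≤ B) :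
    Measure.pi (fun _ : ι => P)
      {d | ((fun j : {i // p i} => d j), fun j : {i // ¬ p i} => d j) ∈ A} ≤ B := by
  have h := measurePreserving_piEquivPiSubtypeProd (fun _ : ι => P) p
  have h1 := h.measure_preimage hA.nullMeasurableSet
  change Measure.pi (fun _ : ι => P)
    ((MeasurableEquiv.piEquivPiSubtypeProd (fun _ : ι => E) p) ⁻¹' A)
    ≤ B
  rw [h1, Measure.prod_apply hA]
  calc _ ≤ ∫⁻ _, B ∂(Measure.pi fun _ : {i // p i} => P) := lintegral_mono hB
    _ = B := by simp

/-- Chebyshev's inequality for a sum of independent copies. -/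
lemma measure_pi_abs_sum_sub_le {κ : Type*} [Fintype κ] {f : E → ℝ} (hf : Measurable f)
    {v : ℝ≥0} (hv : eLpNorm f 2 P ≤ v) {c : ℝ} (hc : 0 < c) :
    Measure.pi (fun _ : κ => P) {x | c ≤ |∑ i, (f (x i) - ∫ y, f y ∂P)|}
      ≤ Fintype.card κ * (v : ℝ≥0∞) ^ 2 / ENNReal.ofReal (c ^ 2) := by
  have hfL : MemLp f 2 P := ⟨hf.aestronglyMeasurable, hv.trans_lt ENNReal.coe_lt_top⟩
  have hi (i : κ) : MemLp (fun x : κ → E => f (x i)) 2 (Measure.pi fun _ : κ => P) :=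
    hfL.comp_measurePreserving (measurePreserving_eval (fun _ : κ => P) i)
  have hsum : MemLp (∑ i : κ, fun x : κ → E => f (x i)) 2 (Measure.pi fun _ : κ => P) :=
    memLp_finsetSum' _ fun i _ => hi i
  have hmean : ∫ x, (∑ i : κ, fun x : κ → E => f (x i)) x ∂(Measure.pi fun _ : κ => P)
      = ∑ _i : κ, ∫ y, f y ∂P := by
    simp only [Finset.sum_apply]
    rw [integral_finsetSum _ fun i _ => (hi i).integrable one_le_two]
    refine Finset.sum_congr rfl fun i _ => ?_
    exact integral_comp_eval (μ := fun _ : κ => P) hf.aestronglyMeasurable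
  have hcheb := meas_ge_le_variance_div_sq hsum hc
  rw [hmean, variance_sum_pi (X := fun _ => f) fun _ => hfL] at hcheb
  refine (le_of_eq ?_).trans (hcheb.trans ?_)
  · congr 1
    ext x
    simp [Finset.sum_apply]
  · rw [ENNReal.ofReal_div_of_pos (by positivity)]
    gcongr
    rw [Finset.sum_const, nsmul_eq_mul, Finset.card_univ, ENNReal.ofReal_mul (by positivity),
      ENNReal.ofReal_natCast]
    gcongr
    calc ENNReal.ofReal (Var[f; P]) ≤ ENNReal.ofReal (∫ x, f x ^ 2 ∂P) :=
          ENNReal.ofReal_le_ofReal (variance_le_expectation_sq hf.aestronglyMeasurable)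
      _ = ∫⁻ x, ‖f x‖ₑ ^ 2 ∂P := by
        rw [ofReal_integral_eq_lintegral_ofReal hfL.integrable_sq
          (ae_of_all _ fun x => sq_nonneg _)]
        refine lintegral_congr fun x => ?_
        rw [← ofReal_norm, ← ENNReal.ofReal_pow (norm_nonneg _), Real.norm_eq_abs, sq_abs]
      _ = eLpNorm f 2 P ^ 2 := (eLpNorm_two_sq P f).symm
      _ ≤ (v : ℝ≥0∞) ^ 2 := by gcongr

/-- Markov's inequality for a sum of squares of independent copies. -/
lemma measure_pi_sum_sq_le {κ : Type*} [Fintype κ] {f : E → ℝ} (hf : Measurable f)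
    {v : ℝ≥0} (hv : eLpNorm f 2 P ≤ v) {c : ℝ} (hc : 0 < c) :
    Measure.pi (fun _ : κ => P) {x | c ≤ ∑ i, f (x i) ^ 2}
      ≤ Fintype.card κ * (v : ℝ≥0∞) ^ 2 / ENNReal.ofReal c := by
  have hset : {x : κ → E | c ≤ ∑ i, f (x i) ^ 2} ⊆
      {x | ENNReal.ofReal c ≤ ∑ i, ‖f (x i)‖ₑ ^ 2} := fun x hx => by
    refine (ENNReal.ofReal_le_ofReal hx).trans_eq ?_
    rw [ENNReal.ofReal_sum_of_nonneg fun i _ => sq_nonneg _]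
    refine Finset.sum_congr rfl fun i _ => ?_
    rw [← ofReal_norm, ← ENNReal.ofReal_pow (norm_nonneg _), Real.norm_eq_abs, sq_abs]
  refine (measure_mono hset).trans ?_
  have hm (i : κ) : Measurable fun x : κ → E => ‖f (x i)‖ₑ ^ 2 :=
    ((hf.comp (measurable_pi_apply i)).enorm).pow_const 2
  refine (meas_ge_le_lintegral_div (Finset.measurable_sum _ fun i _ => hm i).aemeasurable
    (by simpa using hc) ENNReal.ofReal_ne_top).trans ?_
  gcongr
  rw [lintegral_finsetSum _ fun i _ => hm i]
  calc _ = ∑ _i : κ, ∫⁻ y, ‖f y‖ₑ ^ 2 ∂P := Finset.sum_congr rfl fun i _ =>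
        (measurePreserving_eval (fun _ : κ => P) i).lintegral_comp (f := fun y => ‖f y‖ₑ ^ 2)
          (hf.enorm.pow_const 2)
    _ ≤ _ := by
      rw [Finset.sum_const, nsmul_eq_mul, Finset.card_univ, ← eLpNorm_two_sq]
      gcongr

lemma measurable_eLpNorm_two_section {T : Type*} [MeasurableSpace T] {h : T → E → ℝ}
    (hh : Measurable fun p : T × E => h p.1 p.2) : Measurable fun t => eLpNorm (h t) 2 P := by
  simp only [eLpNorm_eq_lintegral_rpow_enorm_toReal two_ne_zero ENNReal.ofNat_ne_top]
  exact ((hh.enorm.pow_const _).lintegral_prod_right').pow_const _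

lemma measurable_integral_section {T : Type*} [MeasurableSpace T] {h : T → E → ℝ}
    (hh : Measurable fun p : T × E => h p.1 p.2) : Measurable fun t => ∫ y, h t y ∂P :=
  (hh.stronglyMeasurable.integral_prod_right').measurable

end ProductConcentration

/-! ### Concentration of held-out sums for a fixed partition -/

section FoldConcentration

variable {𝓧 𝓦 : Type*} [MeasurableSpace 𝓧] [MeasurableSpace 𝓦]
variable (P : Measure (Obs 𝓧 𝓦)) [IsProbabilityMeasure P] {K n : ℕ}

@[fun_prop]
lemma measurable_training (s : Fin n → Fin K) (k : Fin K) :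
    Measurable (training (𝓧 := 𝓧) (𝓦 := 𝓦) s k) := by
  unfold training
  fun_prop

lemma sum_fold_eq (s : Fin n → Fin K) (k : Fin K) (f : Fin n → ℝ) :
    ∑ i ∈ fold s k, f i = ∑ i : {j // ¬ s j ≠ k}, f i :=
  Finset.sum_subtype _ (by simp [fold]) f

lemma card_not_ne_le (s : Fin n → Fin K) (k : Fin K) :
    Fintype.card {j // ¬ s j ≠ k} ≤ n :=
  (Fintype.card_subtype_le _).trans_eq (Fintype.card_fin n)

/-- Conditionally on the training sample, a held-out sum concentrates around its mean. -/
lemma measure_pi_fold_deviation_le (s : Fin n → Fin K) (k : Fin K)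
    {h : Training 𝓧 𝓦 s k → Obs 𝓧 𝓦 → ℝ}
    (hh : Measurable fun p : Training 𝓧 𝓦 s k × Obs 𝓧 𝓦 => h p.1 p.2)
    (v : ℝ≥0) {c : ℝ} (hc : 0 < c) :
    MeasurableSet {d : Fin n → Obs 𝓧 𝓦 | eLpNorm (h (training s k d)) 2 P ≤ v ∧
      c ≤ |∑ i ∈ fold s k, (h (training s k d) (d i) - ∫ o, h (training s k d) o ∂P)|} ∧
    Measure.pi (fun _ : Fin n => P) {d | eLpNorm (h (training s k d)) 2 P ≤ v ∧
      c ≤ |∑ i ∈ fold s k, (h (training s k d) (d i) - ∫ o, h (training s k d) o ∂P)|}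
      ≤ n * (v : ℝ≥0∞) ^ 2 / ENNReal.ofReal (c ^ 2) := by
  set A : Set (({j // s j ≠ k} → Obs 𝓧 𝓦) × ({j // ¬ s j ≠ k} → Obs 𝓧 𝓦)) :=
    {p | eLpNorm (h p.1) 2 P ≤ v} ∩ {p | c ≤ |∑ i, (h p.1 (p.2 i) - ∫ o, h p.1 o ∂P)|}
  have hA : MeasurableSet A := by
    refine (measurableSet_le ((measurable_eLpNorm_two_section P hh).comp measurable_fst)
      measurable_const).inter (measurableSet_le measurable_const ?_)
    have hi (i : {j // ¬ s j ≠ k}) :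
        Measurable fun p : ({j // s j ≠ k} → Obs 𝓧 𝓦) × ({j // ¬ s j ≠ k} → Obs 𝓧 𝓦) =>
          h p.1 (p.2 i) - ∫ o, h p.1 o ∂P :=
      (hh.comp (measurable_fst.prodMk ((measurable_pi_apply i).comp measurable_snd))).sub
        ((measurable_integral_section P hh).comp measurable_fst)
    exact (Finset.measurable_sum _ fun i _ => hi i).norm
  have hset : {d : Fin n → Obs 𝓧 𝓦 | eLpNorm (h (training s k d)) 2 P ≤ v ∧
      c ≤ |∑ i ∈ fold s k, (h (training s k d) (d i) - ∫ o, h (training s k d) o ∂P)|}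
      = {d | ((fun j => d j), fun j => d j) ∈ A} := by
    ext d
    simp only [sum_fold_eq]
    rfl
  rw [hset]
  refine ⟨hA.preimage (by fun_prop), measure_pi_le_of_section_le P _ hA fun t => ?_⟩
  -- The event contains the norm bound itself, so a training sample violating it has an empty
  -- section. This makes the bound uniform over training samples.
  by_cases ht : eLpNorm (h t) 2 P ≤ v
  · refine (measure_mono fun x hx => hx.2).trans ((measure_pi_abs_sum_sub_le P
      (hh.comp measurable_prodMk_left) ht hc).trans ?_)
    gcongr
    exact card_not_ne_le s k
  · have : Prod.mk t ⁻¹' A = ∅ := Set.eq_empty_of_forall_notMem fun x hx => ht hx.1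
    simp [this]

/-- Conditionally on the training sample, a held-out sum of squares is controlled by its mean. -/
lemma measure_pi_fold_sum_sq_le (s : Fin n → Fin K) (k : Fin K)
    {h : Training 𝓧 𝓦 s k → Obs 𝓧 𝓦 → ℝ}
    (hh : Measurable fun p : Training 𝓧 𝓦 s k × Obs 𝓧 𝓦 => h p.1 p.2)
    (v : ℝ≥0) {c : ℝ} (hc : 0 < c) :
    MeasurableSet {d : Fin n → Obs 𝓧 𝓦 | eLpNorm (h (training s k d)) 2 P ≤ v ∧
      c ≤ ∑ i ∈ fold s k, h (training s k d) (d i) ^ 2} ∧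
    Measure.pi (fun _ : Fin n => P) {d | eLpNorm (h (training s k d)) 2 P ≤ v ∧
      c ≤ ∑ i ∈ fold s k, h (training s k d) (d i) ^ 2}
      ≤ n * (v : ℝ≥0∞) ^ 2 / ENNReal.ofReal c := by
  set A : Set (({j // s j ≠ k} → Obs 𝓧 𝓦) × ({j // ¬ s j ≠ k} → Obs 𝓧 𝓦)) :=
    {p | eLpNorm (h p.1) 2 P ≤ v} ∩ {p | c ≤ ∑ i, h p.1 (p.2 i) ^ 2}
  have hA : MeasurableSet A := by
    refine (measurableSet_le ((measurable_eLpNorm_two_section P hh).comp measurable_fst)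
      measurable_const).inter (measurableSet_le measurable_const ?_)
    refine Finset.measurable_sum _ fun i _ => Measurable.pow_const ?_ 2
    exact hh.comp (measurable_fst.prodMk ((measurable_pi_apply i).comp measurable_snd))
  have hset : {d : Fin n → Obs 𝓧 𝓦 | eLpNorm (h (training s k d)) 2 P ≤ v ∧
      c ≤ ∑ i ∈ fold s k, h (training s k d) (d i) ^ 2}
      = {d | ((fun j => d j), fun j => d j) ∈ A} := by
    ext d
    simp only [sum_fold_eq]
    rfl
  rw [hset]
  refine ⟨hA.preimage (by fun_prop), measure_pi_le_of_section_le P _ hA fun t => ?_⟩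
  by_cases ht : eLpNorm (h t) 2 P ≤ v
  · refine (measure_mono fun x hx => hx.2).trans ((measure_pi_sum_sq_le P
      (hh.comp measurable_prodMk_left) ht hc).trans ?_)
    gcongr
    exact card_not_ne_le s k
  · have : Prod.mk t ⁻¹' A = ∅ := Set.eq_empty_of_forall_notMem fun x hx => ht hx.1
    simp [this]

end FoldConcentration

/-! ### From fixed to random partitions -/

section RandomPartition

variable {𝓧 𝓦 Ω : Type*} [MeasurableSpace 𝓧] [MeasurableSpace 𝓦] [MeasurableSpace Ω]
variable (P : Measure (Obs 𝓧 𝓦)) [IsProbabilityMeasure P] {μ : Measure Ω} [IsProbabilityMeasure μ]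
variable {O : ℕ → Ω → Obs 𝓧 𝓦} {K n : ℕ} {S : Ω → (Fin n → Fin K)}

/-- A bound for every fixed partition holds for a partition independent of the data. -/
lemma measure_random_partition_le (hO_meas : ∀ i, Measurable (O i))
    (hO_law : ∀ i, μ.map (O i) = P) (hO_indep : iIndepFun O μ)
    (hS_meas : Measurable S) (hS_indep : IndepFun S (fun ω (i : Fin n) => O i ω) μ)
    {A : (Fin n → Fin K) → Set (Fin n → Obs 𝓧 𝓦)} (hA : ∀ s, MeasurableSet (A s)) {B : ℝ≥0∞}
    (hB : ∀ s, Measure.pi (fun _ : Fin n => P) (A s) ≤ B) :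
    μ {ω | (fun i : Fin n => O i ω) ∈ A (S ω)} ≤ B := by
  have hD : Measurable fun ω (i : Fin n) => O i ω := measurable_pi_lambda _ fun i => hO_meas i
  have hlaw : μ.map (fun ω (i : Fin n) => O i ω) = Measure.pi fun _ : Fin n => P := by
    have h1 : iIndepFun (fun i : Fin n => O i) μ := hO_indep.precomp Fin.val_injective
    have h2 := (iIndepFun_iff_map_fun_eq_pi_map fun i : Fin n => (hO_meas i).aemeasurable).1 h1
    simpa only [hO_law] using h2
  have hprod := (indepFun_iff_map_prod_eq_prod_map_map hS_meas.aemeasurable hD.aemeasurable).1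
    hS_indep
  -- There are finitely many partitions, so measurability of each section is enough.
  have hM : MeasurableSet {p : (Fin n → Fin K) × (Fin n → Obs 𝓧 𝓦) | p.2 ∈ A p.1} := by
    have : {p : (Fin n → Fin K) × (Fin n → Obs 𝓧 𝓦) | p.2 ∈ A p.1} = ⋃ s, {s} ×ˢ A s := by
      ext p; simp
    rw [this]
    exact MeasurableSet.iUnion fun s => (measurableSet_singleton s).prod (hA s)
  have hpS : IsProbabilityMeasure (μ.map S) := Measure.isProbabilityMeasure_map hS_meas.aemeasurable
  calc μ {ω | (fun i : Fin n => O i ω) ∈ A (S ω)}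
      = μ.map (fun ω => (S ω, fun i : Fin n => O i ω)) {p | p.2 ∈ A p.1} :=
        (Measure.map_apply (hS_meas.prodMk hD) hM).symm
    _ = ∫⁻ s, Measure.pi (fun _ : Fin n => P) (A s) ∂(μ.map S) := by
      rw [hprod, hlaw, Measure.prod_apply hM]
      rfl
    _ ≤ ∫⁻ _, B ∂(μ.map S) := lintegral_mono hB
    _ = B := by simp

variable {h : ∀ (s : Fin n → Fin K) (k : Fin K), Training 𝓧 𝓦 s k → Obs 𝓧 𝓦 → ℝ}

/-- Sum over all observations of a held-out function. -/
lemma sum_eq_sum_fold (s : Fin n → Fin K) (f : Fin n → ℝ) :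
    ∑ i, f i = ∑ k, ∑ i ∈ fold s k, f i :=
  (Finset.sum_fiberwise _ s f).symm

/-- Each fold may deviate from its conditional mean by `n * c / K`, which adds up to `n * c`; the
conditional means contribute at most `c` per observation, another `n * c`. Chebyshev on each fold
with a union bound gives `K * n * v ^ 2 / (n * c / K) ^ 2`, the stated probability. -/
lemma measure_mean_heldOut_le (hO_meas : ∀ i, Measurable (O i))
    (hO_law : ∀ i, μ.map (O i) = P) (hO_indep : iIndepFun O μ)
    (hS_meas : Measurable S) (hS_indep : IndepFun S (fun ω (i : Fin n) => O i ω) μ)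
    (hh : ∀ s k, Measurable fun p : Training 𝓧 𝓦 s k × Obs 𝓧 𝓦 => h s k p.1 p.2)
    (hK : 0 < K) (hn : 0 < n) (v : ℝ≥0) {c : ℝ} (hc : 0 < c) :
    μ {ω | (∀ k, eLpNorm (h (S ω) k (training (S ω) k fun i => O i ω)) 2 P ≤ v) ∧
        (∀ k, |∫ o, h (S ω) k (training (S ω) k fun i => O i ω) o ∂P| ≤ c) ∧
        2 * c < |1 / (n : ℝ) * ∑ i : Fin n,
          h (S ω) (S ω i) (training (S ω) (S ω i) fun i => O i ω) (O i ω)|}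
      ≤ ENNReal.ofReal (K ^ 3 * v ^ 2 / (n * c ^ 2)) := by
  have hn' : (0 : ℝ) < n := by exact_mod_cast hn
  have hK' : (0 : ℝ) < K := by exact_mod_cast hK
  have hc' : 0 < n * c / K := by positivity
  set A : (Fin n → Fin K) → Set (Fin n → Obs 𝓧 𝓦) := fun s =>
    ⋃ k, {d | eLpNorm (h s k (training s k d)) 2 P ≤ v ∧ n * c / K ≤ |∑ i ∈ fold s k,
      (h s k (training s k d) (d i) - ∫ o, h s k (training s k d) o ∂P)|}
  have hA : ∀ s, MeasurableSet (A s) := fun s => MeasurableSet.iUnion fun k =>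
    (measure_pi_fold_deviation_le P s k (hh s k) v hc').1
  have hB : ∀ s, Measure.pi (fun _ : Fin n => P) (A s) ≤
      ENNReal.ofReal (K ^ 3 * v ^ 2 / (n * c ^ 2)) := fun s => by
    refine (measure_iUnion_fintype_le _ _).trans ((Finset.sum_le_sum fun k _ =>
      (measure_pi_fold_deviation_le P s k (hh s k) v hc').2).trans_eq ?_)
    rw [Finset.sum_const, Finset.card_univ, Fintype.card_fin, nsmul_eq_mul,
      ← ENNReal.ofReal_natCast K, ← ENNReal.ofReal_natCast n, ← ENNReal.ofReal_coe_nnreal,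
      ← ENNReal.ofReal_pow (by positivity), ← ENNReal.ofReal_mul (by positivity),
      ← ENNReal.ofReal_div_of_pos (by positivity), ← ENNReal.ofReal_mul (by positivity)]
    congr 1
    field_simp
  refine (measure_mono fun ω hω => ?_).trans
    (measure_random_partition_le P hO_meas hO_law hO_indep hS_meas hS_indep hA hB)
  obtain ⟨h1, h2, h3⟩ := hω
  by_contra hcon
  simp only [A, Set.mem_ofPred_eq, Set.mem_iUnion, not_exists, not_and, not_le] at hcon
  refine absurd h3 (not_lt.2 ?_)
  set s := S ω
  set d : Fin n → Obs 𝓧 𝓦 := fun i => O i ω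
  have hfold (k : Fin K) : |∑ i ∈ fold s k, h s (s i) (training s (s i) d) (d i)|
      ≤ n * c / K + (fold s k).card * c := by
    have e : ∑ i ∈ fold s k, h s (s i) (training s (s i) d) (d i) =
        ∑ i ∈ fold s k, (h s k (training s k d) (d i) - ∫ o, h s k (training s k d) o ∂P)
          + (fold s k).card * ∫ o, h s k (training s k d) o ∂P := by
      rw [Finset.sum_sub_distrib, Finset.sum_const, nsmul_eq_mul, sub_add_cancel]
      refine Finset.sum_congr rfl fun i hi => ?_
      obtain rfl : s i = k := by simpa [fold] using hi
      rfl
    rw [e]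
    refine (abs_add_le _ _).trans (add_le_add (hcon k (h1 k)).le ?_)
    rw [abs_mul, Nat.abs_cast]
    gcongr
    exact h2 k
  have hcard : ∑ k, ((fold s k).card : ℝ) = n := by
    have := sum_eq_sum_fold s fun _ => (1 : ℝ)
    simpa using this.symm
  rw [abs_mul, abs_of_pos (by positivity), sum_eq_sum_fold s]
  calc 1 / (n : ℝ) * |∑ k, ∑ i ∈ fold s k, h s (s i) (training s (s i) d) (d i)|
      ≤ 1 / (n : ℝ) * ∑ k : Fin K, (n * c / K + (fold s k).card * c) := by
        gcongr
        exact (Finset.abs_sum_le_sum_abs _ _).trans (Finset.sum_le_sum fun k _ => hfold k)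
    _ = 2 * c := by
      rw [Finset.sum_add_distrib, ← Finset.sum_mul, hcard, Finset.sum_const, Finset.card_univ,
        Fintype.card_fin, nsmul_eq_mul]
      field_simp
      ring

/-- Each fold is allowed a share `n * c / K` of the sum of squares. Markov's inequality and a union
bound give `K * n * v ^ 2 / (n * c / K)`, which does not depend on `n`. -/
lemma measure_mean_sq_heldOut_le (hO_meas : ∀ i, Measurable (O i))
    (hO_law : ∀ i, μ.map (O i) = P) (hO_indep : iIndepFun O μ)
    (hS_meas : Measurable S) (hS_indep : IndepFun S (fun ω (i : Fin n) => O i ω) μ)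
    (hh : ∀ s k, Measurable fun p : Training 𝓧 𝓦 s k × Obs 𝓧 𝓦 => h s k p.1 p.2)
    (hK : 0 < K) (hn : 0 < n) (v : ℝ≥0) {c : ℝ} (hc : 0 < c) :
    μ {ω | (∀ k, eLpNorm (h (S ω) k (training (S ω) k fun i => O i ω)) 2 P ≤ v) ∧
        c < 1 / (n : ℝ) * ∑ i : Fin n,
          h (S ω) (S ω i) (training (S ω) (S ω i) fun i => O i ω) (O i ω) ^ 2}
      ≤ ENNReal.ofReal (K ^ 2 * v ^ 2 / c) := by
  have hn' : (0 : ℝ) < n := by exact_mod_cast hn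
  have hK' : (0 : ℝ) < K := by exact_mod_cast hK
  have hc' : 0 < n * c / K := by positivity
  set A : (Fin n → Fin K) → Set (Fin n → Obs 𝓧 𝓦) := fun s =>
    ⋃ k, {d | eLpNorm (h s k (training s k d)) 2 P ≤ v ∧ n * c / K ≤ ∑ i ∈ fold s k,
      h s k (training s k d) (d i) ^ 2}
  have hA : ∀ s, MeasurableSet (A s) := fun s => MeasurableSet.iUnion fun k =>
    (measure_pi_fold_sum_sq_le P s k (hh s k) v hc').1
  have hB : ∀ s, Measure.pi (fun _ : Fin n => P) (A s) ≤
      ENNReal.ofReal (K ^ 2 * v ^ 2 / c) := fun s => by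
    refine (measure_iUnion_fintype_le _ _).trans ((Finset.sum_le_sum fun k _ =>
      (measure_pi_fold_sum_sq_le P s k (hh s k) v hc').2).trans_eq ?_)
    rw [Finset.sum_const, Finset.card_univ, Fintype.card_fin, nsmul_eq_mul,
      ← ENNReal.ofReal_natCast K, ← ENNReal.ofReal_natCast n, ← ENNReal.ofReal_coe_nnreal,
      ← ENNReal.ofReal_pow (by positivity), ← ENNReal.ofReal_mul (by positivity),
      ← ENNReal.ofReal_div_of_pos (by positivity), ← ENNReal.ofReal_mul (by positivity)]
    congr 1
    field_simp
  refine (measure_mono fun ω hω => ?_).trans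
    (measure_random_partition_le P hO_meas hO_law hO_indep hS_meas hS_indep hA hB)
  obtain ⟨h1, h3⟩ := hω
  by_contra hcon
  simp only [A, Set.mem_ofPred_eq, Set.mem_iUnion, not_exists, not_and, not_le] at hcon
  refine absurd h3 (not_lt.2 ?_)
  set s := S ω
  set d : Fin n → Obs 𝓧 𝓦 := fun i => O i ω
  have hfold (k : Fin K) : ∑ i ∈ fold s k, h s (s i) (training s (s i) d) (d i) ^ 2
      ≤ n * c / K := by
    refine (le_of_eq ?_).trans (hcon k (h1 k)).le
    refine Finset.sum_congr rfl fun i hi => ?_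
    obtain rfl : s i = k := by simpa [fold] using hi
    rfl
  rw [sum_eq_sum_fold s]
  calc 1 / (n : ℝ) * ∑ k, ∑ i ∈ fold s k, h s (s i) (training s (s i) d) (d i) ^ 2
      ≤ 1 / (n : ℝ) * ∑ k : Fin K, n * c / K := by
        gcongr with k
        exact hfold k
    _ = c := by
      rw [Finset.sum_const, Finset.card_univ, Fintype.card_fin, nsmul_eq_mul]
      field_simp

end RandomPartition

/-- The sampling, cross-fitting, moment and positivity assumptions, bundled. -/
structure CrossFitSetup {𝓧 𝓦 Ω : Type*} [MeasurableSpace 𝓧] [MeasurableSpace 𝓦]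
    [MeasurableSpace Ω] (P : Measure (Obs 𝓧 𝓦)) [IsProbabilityMeasure P] (μ : Measure Ω)
    (O : ℕ → Ω → Obs 𝓧 𝓦) {K : ℕ} (S : ∀ n : ℕ, Ω → (Fin n → Fin K))
    (Qhat : Learner 𝓧 𝓦 K (Fin 2 → 𝓦 × 𝓧 → ℝ)) (ghat : Learner 𝓧 𝓦 K (𝓦 × 𝓧 → ℝ))
    (ε₀ ε : ℝ) : Prop where
  obs_meas : ∀ i, Measurable (O i)
  obs_law : ∀ i, μ.map (O i) = P
  obs_indep : iIndepFun O μ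
  folds_pos : 0 < K
  part_meas : ∀ n, Measurable (S n)
  part_indep : ∀ n, IndepFun (S n) (fun ω (i : Fin n) => O i ω) μ
  Qhat_meas : ∀ (n : ℕ) (s : Fin n → Fin K) (k : Fin K) (a : Fin 2),
    Measurable fun p : Training 𝓧 𝓦 s k × (𝓦 × 𝓧) => Qhat n s k p.1 a p.2
  ghat_meas : ∀ (n : ℕ) (s : Fin n → Fin K) (k : Fin K),
    Measurable fun p : Training 𝓧 𝓦 s k × (𝓦 × 𝓧) => ghat n s k p.1 p.2
  outcome_memLp : MemLp (outcome : Obs 𝓧 𝓦 → ℝ) 2 P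
  outcomeReg_memLp : ∀ a : Fin 2, MemLp (fun o => outcomeReg P a (covs o)) 2 P
  propensity_lb : 0 < ε₀
  propensity_bounds : ∀ᵐ o ∂P, ε₀ ≤ propensity P (covs o) ∧ propensity P (covs o) ≤ 1 - ε₀
  ghat_lb : 0 < ε
  ghat_bounds : Tendsto (fun n : ℕ => μ {ω | ¬ ∀ (k : Fin K) (wx : 𝓦 × 𝓧),
      ε ≤ ghat n (S n ω) k (training (S n ω) k fun i => O i ω) wx ∧
      ghat n (S n ω) k (training (S n ω) k fun i => O i ω) wx ≤ 1 - ε}) atTop (𝓝 0)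

/-- The constant `C` lets several exceptional events, each of probability at most `η`, be added
without splitting `η` beforehand. -/
lemma tendsto_zero_of_eventually_le_mul {f : ℕ → ℝ≥0∞} (C : ℝ≥0)
    (h : ∀ η : ℝ≥0, 0 < η → ∀ᶠ n in atTop, f n ≤ C * η) : Tendsto f atTop (𝓝 0) := by
  rw [ENNReal.tendsto_nhds_zero]
  intro η hη
  obtain ⟨η', hη', hlt⟩ := ENNReal.exists_nnreal_pos_mul_lt (a := C) (b := η)
    ENNReal.coe_ne_top hη.ne'
  filter_upwards [h η' hη'] with n hn
  refine hn.trans ?_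
  rw [mul_comm]
  exact hlt.le

/-! ### Negligibility of the held-out errors -/

section Remainder

variable {𝓧 𝓦 Ω : Type*} [MeasurableSpace 𝓧] [MeasurableSpace 𝓦] [MeasurableSpace Ω]
variable {P : Measure (Obs 𝓧 𝓦)} [IsProbabilityMeasure P] {μ : Measure Ω}
variable {O : ℕ → Ω → Obs 𝓧 𝓦} {K : ℕ} {S : ∀ n : ℕ, Ω → (Fin n → Fin K)}
variable {Qhat : Learner 𝓧 𝓦 K (Fin 2 → 𝓦 × 𝓧 → ℝ)} {ghat : Learner 𝓧 𝓦 K (𝓦 × 𝓧 → ℝ)}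
variable {ε₀ ε : ℝ}

variable (P Qhat ghat) in
/-- The score error of the nuisances fitted without fold `k`. -/
noncomputable def foldError {n : ℕ} (s : Fin n → Fin K) (k : Fin K) (t : Training 𝓧 𝓦 s k) :
    Obs 𝓧 𝓦 → ℝ :=
  scoreError P (Qhat n s k t) (ghat n s k t)

variable (P O S Qhat ghat) in
/-- The score error of observation `i` under its held-out nuisances. -/
noncomputable def heldOutError (n : ℕ) (ω : Ω) (i : Fin n) : ℝ :=
  foldError P Qhat ghat (S n ω) (S n ω i) (training (S n ω) (S n ω i) fun i => O i ω) (O i ω)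

variable (O S ghat ε) in
/-- The fitted propensities of all folds respect the positivity bounds. -/
def Positivity (n : ℕ) (ω : Ω) : Prop :=
  ∀ (k : Fin K) (wx : 𝓦 × 𝓧),
    ε ≤ ghat n (S n ω) k (training (S n ω) k fun i => O i ω) wx ∧
    ghat n (S n ω) k (training (S n ω) k fun i => O i ω) wx ≤ 1 - ε

lemma sum_l2norm_le_outcomeError {n : ℕ} (s : Fin n → Fin K) (d : Fin n → Obs 𝓧 𝓦) (k : Fin K) :
    ∑ a, l2norm P (fun wx => Qhat n s k (training s k d) a wx - outcomeReg P a wx)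
      ≤ outcomeError P Qhat s d :=
  le_iSup (fun k => ∑ a, l2norm P
    (fun wx => Qhat n s k (training s k d) a wx - outcomeReg P a wx)) k

lemma l2norm_le_propensityError {n : ℕ} (s : Fin n → Fin K) (d : Fin n → Obs 𝓧 𝓦) (k : Fin K) :
    l2norm P (fun wx => ghat n s k (training s k d) wx - propensity P wx)
      ≤ propensityError P ghat s d :=
  le_iSup (fun k => l2norm P (fun wx => ghat n s k (training s k d) wx - propensity P wx)) k

variable (H : CrossFitSetup P μ O S Qhat ghat ε₀ ε)
include H

lemma CrossFitSetup.measurable_foldError {n : ℕ} (s : Fin n → Fin K) (k : Fin K) :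
    Measurable fun p : Training 𝓧 𝓦 s k × Obs 𝓧 𝓦 => foldError P Qhat ghat s k p.1 p.2 :=
  (measurable_score_param (H.Qhat_meas n s k) (H.ghat_meas n s k)).sub
    ((measurable_score (measurable_outcomeReg P) (measurable_propensity P)).comp measurable_snd)

lemma CrossFitSetup.measurable_Qhat {n : ℕ} (s : Fin n → Fin K) (k : Fin K)
    (t : Training 𝓧 𝓦 s k) (a : Fin 2) : Measurable (Qhat n s k t a) :=
  (H.Qhat_meas n s k a).comp measurable_prodMk_left

lemma CrossFitSetup.measurable_ghat {n : ℕ} (s : Fin n → Fin K) (k : Fin K)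
    (t : Training 𝓧 𝓦 s k) : Measurable (ghat n s k t) :=
  (H.ghat_meas n s k).comp measurable_prodMk_left

lemma CrossFitSetup.eLpNorm_foldError_le {n : ℕ} {ω : Ω} (hω : Positivity O S ghat ε n ω)
    (k : Fin K) :
    eLpNorm (foldError P Qhat ghat (S n ω) k (training (S n ω) k fun i => O i ω)) 2 P
      ≤ (1 / (ε * ε₀)).toNNReal * eLpNorm (residual P) 2 P
        + (1 + 1 / ε).toNNReal * outcomeError P Qhat (S n ω) fun i => O i ω :=
  (eLpNorm_scoreError_le_of_bounded P H.propensity_lb H.propensity_bounds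
    (H.measurable_Qhat _ _ _) (H.measurable_ghat _ _ _) H.ghat_lb (hω k)).trans
    (by gcongr; exact sum_l2norm_le_outcomeError _ _ k)

/-- This is the second-order bias bound, uniform over folds. Finiteness of the outcome error is a
separate assumption: since `0 * ∞ = 0`, it does not follow from the bound on the product. -/
lemma CrossFitSetup.abs_integral_foldError_le {n : ℕ} {ω : Ω} (hω : Positivity O S ghat ε n ω)
    (hfin : outcomeError P Qhat (S n ω) (fun i => O i ω) ≠ ∞) {c : ℝ} (hc : 0 ≤ c)
    (hle : (1 / ε).toNNReal * (propensityError P ghat (S n ω) (fun i => O i ω)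
      * outcomeError P Qhat (S n ω) (fun i => O i ω)) ≤ ENNReal.ofReal c) (k : Fin K) :
    |∫ o, foldError P Qhat ghat (S n ω) k (training (S n ω) k fun i => O i ω) o ∂P| ≤ c := by
  have h1 := sum_l2norm_le_outcomeError (P := P) (Qhat := Qhat) (S n ω) (fun i => O i ω) k
  have h2 := l2norm_le_propensityError (P := P) (ghat := ghat) (S n ω) (fun i => O i ω) k
  have h := enorm_integral_scoreError_le P H.outcome_memLp H.outcomeReg_memLp H.propensity_lb
    H.propensity_bounds (H.measurable_Qhat _ _ _) (H.measurable_ghat _ _ _) H.ghat_lb (hω k)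
    (ne_top_of_le_ne_top hfin h1)
  have h3 := h.trans ((by gcongr : _ ≤ _).trans hle)
  rw [← ofReal_norm, ENNReal.ofReal_le_ofReal_iff hc] at h3
  exact h3

/-- Tail bound for the mean held-out error. -/
lemma CrossFitSetup.measure_mean_heldOutError_le [IsProbabilityMeasure μ]
    {n : ℕ} (hn : 0 < n) (v : ℝ≥0) {c : ℝ}
    (hc : 0 < c) {B : Set Ω}
    (hv : ∀ ω ∉ B, Positivity O S ghat ε n ω → ∀ k,
      eLpNorm (foldError P Qhat ghat (S n ω) k (training (S n ω) k fun i => O i ω)) 2 P ≤ v)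
    (hb : ∀ ω ∉ B, Positivity O S ghat ε n ω → ∀ k,
      |∫ o, foldError P Qhat ghat (S n ω) k (training (S n ω) k fun i => O i ω) o ∂P| ≤ c) :
    μ {ω | 2 * c < |1 / (n : ℝ) * ∑ i, heldOutError P O S Qhat ghat n ω i|}
      ≤ μ {ω | ¬ Positivity O S ghat ε n ω} + μ B
        + ENNReal.ofReal (K ^ 3 * v ^ 2 / (n * c ^ 2)) := by
  refine le_trans ?_ (add_le_add_right (measure_mean_heldOut_le P H.obs_meas H.obs_law H.obs_indep
    (H.part_meas n) (H.part_indep n) (fun s k => H.measurable_foldError s k) H.folds_pos hn v hc) _)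
  -- Only monotonicity and subadditivity of `μ` are used, so neither `B` nor the positivity event,
  -- which quantifies over all `(w, x)`, has to be measurable.
  refine le_trans (measure_mono fun ω hω => ?_)
    ((measure_union_le _ _).trans (add_le_add_left (measure_union_le _ _) _))
  by_cases h1 : Positivity O S ghat ε n ω
  · by_cases h2 : ω ∈ B
    · exact Or.inl (Or.inr h2)
    · exact Or.inr ⟨hv ω h2 h1, hb ω h2 h1, hω⟩
  · exact Or.inl (Or.inl h1)

lemma CrossFitSetup.eventually_not_positivity_le {η : ℝ≥0} (hη : 0 < η) :
    ∀ᶠ n in atTop, μ {ω | ¬ Positivity O S ghat ε n ω} ≤ η :=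
  ENNReal.tendsto_nhds_zero.1 H.ghat_bounds η (by exact_mod_cast hη)

/-- Consistency of the remainder under double robustness. -/
lemma CrossFitSetup.tendstoInMeasure_mean_heldOutError [IsProbabilityMeasure μ]
    (hQ : IsBigOP μ (fun n ω => outcomeError P Qhat (S n ω) fun i => O i ω) (fun _ => 1))
    (hprod : IsLittleOP μ (fun n ω => propensityError P ghat (S n ω) (fun i => O i ω) *
      outcomeError P Qhat (S n ω) fun i => O i ω) (fun _ => 1)) :
    TendstoInMeasure μ
      (fun (n : ℕ) ω => 1 / (n : ℝ) * ∑ i, heldOutError P O S Qhat ghat n ω i) atTop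
      (fun _ => 0) := by
  rw [tendstoInMeasure_iff_norm]
  intro r hr
  have hε := H.ghat_lb
  have hres : eLpNorm (residual P) 2 P ≠ ∞ :=
    (memLp_residual P H.outcome_memLp H.outcomeReg_memLp).2.ne
  refine tendsto_zero_of_eventually_le_mul 4 fun η hη => ?_
  obtain ⟨M, hM⟩ := hQ η hη
  set R := (eLpNorm (residual P) 2 P).toNNReal
  have hR : (R : ℝ≥0∞) = eLpNorm (residual P) 2 P := ENNReal.coe_toNNReal hres
  set v : ℝ≥0 := (1 / (ε * ε₀)).toNNReal * R + (1 + 1 / ε).toNNReal * M with hvdef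
  -- The tail bound controls the event above `2 * c = r / 2`, strictly below `r`. The factor `ε` in
  -- `δ` cancels the `1 / ε` of the bias bound.
  have hc : 0 < r / 4 := by positivity
  set δ : ℝ≥0 := (ε * (r / 4)).toNNReal
  have hδ : 0 < δ := Real.toNNReal_pos.2 (by positivity)
  have h2 := ENNReal.tendsto_nhds_zero.1 (hprod δ hδ) η (by exact_mod_cast hη)
  have h3 : Tendsto (fun n : ℕ => ENNReal.ofReal (K ^ 3 * v ^ 2 / (n * (r / 4) ^ 2))) atTop
      (𝓝 0) := by
    rw [← ENNReal.ofReal_zero]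
    refine ENNReal.tendsto_ofReal (Tendsto.div_atTop tendsto_const_nhds ?_)
    exact tendsto_natCast_atTop_atTop.atTop_mul_const (by positivity)
  filter_upwards [hM, h2, H.eventually_not_positivity_le hη, eventually_gt_atTop 0,
    ENNReal.tendsto_nhds_zero.1 h3 η (by exact_mod_cast hη)] with n hn1 hn2 hn3 hn hn4
  simp only [mul_one] at hn1 hn2
  have key := H.measure_mean_heldOutError_le hn v hc
    (B := {ω | (M : ℝ≥0∞) < outcomeError P Qhat (S n ω) fun i => O i ω} ∪
      {ω | (δ : ℝ≥0∞) < propensityError P ghat (S n ω) (fun i => O i ω) *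
        outcomeError P Qhat (S n ω) fun i => O i ω})
    (fun ω hω hp k => by
      simp only [Set.mem_union, Set.mem_ofPred_eq, not_or, not_lt] at hω
      refine (H.eLpNorm_foldError_le hp k).trans ?_
      rw [hvdef, ENNReal.coe_add, ENNReal.coe_mul, ENNReal.coe_mul, hR]
      gcongr
      exact hω.1)
    (fun ω hω hp k => by
      simp only [Set.mem_union, Set.mem_ofPred_eq, not_or, not_lt] at hω
      refine H.abs_integral_foldError_le hp (ne_top_of_le_ne_top ENNReal.coe_ne_top hω.1) hc.le
        ?_ k
      calc _ ≤ ((1 / ε).toNNReal : ℝ≥0∞) * δ := by gcongr; exact hω.2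
        _ = ENNReal.ofReal (1 / ε * (ε * (r / 4))) := (ENNReal.ofReal_mul (by positivity)).symm
        _ = ENNReal.ofReal (r / 4) := by congr 1; field_simp)
  calc _ ≤ _ := measure_mono fun ω hω => ?_
    _ ≤ _ := key
    _ ≤ η + (η + η) + η := add_le_add (add_le_add hn3
        ((measure_union_le _ _).trans (add_le_add hn1 hn2))) hn4
    _ = _ := by push_cast; ring
  have hω' : r ≤ ‖1 / (n : ℝ) * ∑ i, heldOutError P O S Qhat ghat n ω i - 0‖ := hω
  rw [sub_zero, Real.norm_eq_abs] at hω'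
  change 2 * (r / 4) < _
  linarith

/-- The nuisance errors are eventually so small that the held-out errors are small in `L₂`. -/
lemma CrossFitSetup.exists_eLpNorm_foldError_le {v : ℝ≥0} (hv : 0 < v) :
    ∃ δ : ℝ≥0, 0 < δ ∧ ∀ n ω, Positivity O S ghat ε n ω →
      outcomeError P Qhat (S n ω) (fun i => O i ω) ≤ δ →
      propensityError P ghat (S n ω) (fun i => O i ω) ≤ δ → ∀ k,
      eLpNorm (foldError P Qhat ghat (S n ω) k (training (S n ω) k fun i => O i ω)) 2 P ≤ v := by
  obtain ⟨δ, hδ, h⟩ := exists_eLpNorm_scoreError_le P H.outcome_memLp H.outcomeReg_memLp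
    H.propensity_lb H.propensity_bounds H.ghat_lb hv
  exact ⟨δ, hδ, fun n ω hp hQ hg k => h _ _ (H.measurable_Qhat _ _ _) (H.measurable_ghat _ _ _)
    (hp k) ((sum_l2norm_le_outcomeError _ _ k).trans hQ)
    ((l2norm_le_propensityError _ _ k).trans hg)⟩

/-- Root-`n` negligibility of the remainder. -/
lemma CrossFitSetup.tendstoInMeasure_sqrt_mul_mean_heldOutError [IsProbabilityMeasure μ]
    (hQ : IsLittleOP μ (fun n ω => outcomeError P Qhat (S n ω) fun i => O i ω) (fun _ => 1))
    (hg : IsLittleOP μ (fun n ω => propensityError P ghat (S n ω) fun i => O i ω) (fun _ => 1))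
    (hprod : IsLittleOP μ (fun n ω => propensityError P ghat (S n ω) (fun i => O i ω) *
      outcomeError P Qhat (S n ω) fun i => O i ω) (fun n => (n : ℝ≥0∞) ^ (-(1 / 2) : ℝ))) :
    TendstoInMeasure μ
      (fun (n : ℕ) ω => √(n : ℝ) * (1 / (n : ℝ) * ∑ i, heldOutError P O S Qhat ghat n ω i)) atTop
      (fun _ => 0) := by
  rw [tendstoInMeasure_iff_norm]
  intro r hr
  have hε := H.ghat_lb
  have hK : (0 : ℝ) < K := by exact_mod_cast H.folds_pos
  refine tendsto_zero_of_eventually_le_mul 5 fun η hη => ?_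
  have hη' : (0 : ℝ) < η := by exact_mod_cast hη
  -- This solves `K ^ 3 * v ^ 2 / (n * c ^ 2) = η` for `c = r / 4 / √n`. The sample size cancels, so
  -- one `v`, hence one `δ`, serves every `n`.
  set v : ℝ≥0 := (√(η * (r / 4) ^ 2 / K ^ 3)).toNNReal
  have hv : 0 < v := Real.toNNReal_pos.2 (by positivity)
  have hv2 : (v : ℝ) ^ 2 = η * (r / 4) ^ 2 / K ^ 3 := by
    rw [Real.coe_toNNReal _ (by positivity), Real.sq_sqrt (by positivity)]
  obtain ⟨δ, hδ, hδv⟩ := H.exists_eLpNorm_foldError_le hv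
  set δ' : ℝ≥0 := (ε * (r / 4)).toNNReal
  have hδ' : 0 < δ' := Real.toNNReal_pos.2 (by positivity)
  have h1 := ENNReal.tendsto_nhds_zero.1 (hQ δ hδ) η (by exact_mod_cast hη)
  have h2 := ENNReal.tendsto_nhds_zero.1 (hg δ hδ) η (by exact_mod_cast hη)
  have h3 := ENNReal.tendsto_nhds_zero.1 (hprod δ' hδ') η (by exact_mod_cast hη)
  filter_upwards [h1, h2, h3, H.eventually_not_positivity_le hη, eventually_gt_atTop 0]
    with n hn1 hn2 hn3 hn4 hn
  simp only [mul_one] at hn1 hn2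
  have hn' : (0 : ℝ) < n := by exact_mod_cast hn
  have hsq : 0 < √(n : ℝ) := Real.sqrt_pos.2 hn'
  have hc : 0 < r / 4 / √(n : ℝ) := by positivity
  have hpow : (n : ℝ≥0∞) ^ (-(1 / 2) : ℝ) = ENNReal.ofReal (1 / √(n : ℝ)) := by
    rw [← ENNReal.ofReal_natCast, ENNReal.ofReal_rpow_of_pos hn', Real.rpow_neg hn'.le,
      ← Real.sqrt_eq_rpow, one_div]
  have key := H.measure_mean_heldOutError_le hn v hc
    (B := ({ω | (δ : ℝ≥0∞) < outcomeError P Qhat (S n ω) fun i => O i ω} ∪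
      {ω | (δ : ℝ≥0∞) < propensityError P ghat (S n ω) fun i => O i ω}) ∪
      {ω | (δ' : ℝ≥0∞) * (n : ℝ≥0∞) ^ (-(1 / 2) : ℝ) <
        propensityError P ghat (S n ω) (fun i => O i ω) *
        outcomeError P Qhat (S n ω) fun i => O i ω})
    (fun ω hω hp k => by
      simp only [Set.mem_union, Set.mem_ofPred_eq, not_or, not_lt] at hω
      exact hδv n ω hp hω.1.1 hω.1.2 k)
    (fun ω hω hp k => by
      simp only [Set.mem_union, Set.mem_ofPred_eq, not_or, not_lt] at hω
      refine H.abs_integral_foldError_le hp (ne_top_of_le_ne_top ENNReal.coe_ne_top hω.1.1) hc.le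
        ?_ k
      calc _ ≤ ((1 / ε).toNNReal : ℝ≥0∞) * (δ' * ENNReal.ofReal (1 / √(n : ℝ))) := by
            rw [← hpow]; exact mul_le_mul_right hω.2 _
        _ = ENNReal.ofReal (1 / ε * (ε * (r / 4) * (1 / √(n : ℝ)))) := by
          rw [ENNReal.ofReal_mul (by positivity), ENNReal.ofReal_mul (by positivity)]
          rfl
        _ = ENNReal.ofReal (r / 4 / √(n : ℝ)) := by congr 1; field_simp)
  have hlast : ENNReal.ofReal (K ^ 3 * v ^ 2 / (n * (r / 4 / √(n : ℝ)) ^ 2)) = η := by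
    rw [hv2, div_pow (r / 4) (√(n : ℝ)), Real.sq_sqrt hn'.le, ← ENNReal.ofReal_coe_nnreal]
    congr 1
    field_simp
  calc _ ≤ _ := measure_mono fun ω hω => ?_
    _ ≤ _ := key
    _ ≤ η + (η + η + η) + η := add_le_add (add_le_add hn4 ((measure_union_le _ _).trans
        (add_le_add ((measure_union_le _ _).trans (add_le_add hn1 hn2)) hn3))) hlast.le
    _ = _ := by push_cast; ring
  have hω' : r ≤ ‖√(n : ℝ) * (1 / (n : ℝ) * ∑ i, heldOutError P O S Qhat ghat n ω i) - 0‖ := hω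
  rw [sub_zero, norm_mul, Real.norm_of_nonneg hsq.le, Real.norm_eq_abs] at hω'
  change 2 * (r / 4 / √(n : ℝ)) < _
  rw [← mul_div_assoc, div_lt_iff₀ hsq]
  linarith

/-- The mean squared held-out error is negligible. -/
lemma CrossFitSetup.tendstoInMeasure_mean_sq_heldOutError [IsProbabilityMeasure μ]
    (hQ : IsLittleOP μ (fun n ω => outcomeError P Qhat (S n ω) fun i => O i ω) (fun _ => 1))
    (hg : IsLittleOP μ (fun n ω => propensityError P ghat (S n ω) fun i => O i ω) (fun _ => 1)) :
    TendstoInMeasure μ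
      (fun (n : ℕ) ω => 1 / (n : ℝ) * ∑ i, heldOutError P O S Qhat ghat n ω i ^ 2) atTop
      (fun _ => 0) := by
  rw [tendstoInMeasure_iff_norm]
  intro r hr
  have hK : (0 : ℝ) < K := by exact_mod_cast H.folds_pos
  refine tendsto_zero_of_eventually_le_mul 4 fun η hη => ?_
  have hη' : (0 : ℝ) < η := by exact_mod_cast hη
  -- Chosen so that the Markov bound `K ^ 2 * v ^ 2 / (r / 2)` equals `η`.
  set v : ℝ≥0 := (√(η * (r / 2) / K ^ 2)).toNNReal
  have hv : 0 < v := Real.toNNReal_pos.2 (by positivity)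
  have hv2 : (v : ℝ) ^ 2 = η * (r / 2) / K ^ 2 := by
    rw [Real.coe_toNNReal _ (by positivity), Real.sq_sqrt (by positivity)]
  obtain ⟨δ, hδ, hδv⟩ := H.exists_eLpNorm_foldError_le hv
  have h1 := ENNReal.tendsto_nhds_zero.1 (hQ δ hδ) η (by exact_mod_cast hη)
  have h2 := ENNReal.tendsto_nhds_zero.1 (hg δ hδ) η (by exact_mod_cast hη)
  filter_upwards [h1, h2, H.eventually_not_positivity_le hη, eventually_gt_atTop 0]
    with n hn1 hn2 hn4 hn
  simp only [mul_one] at hn1 hn2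
  have hn' : (0 : ℝ) < n := by exact_mod_cast hn
  have key := measure_mean_sq_heldOut_le P H.obs_meas H.obs_law H.obs_indep
    (H.part_meas n) (H.part_indep n) (fun s k => H.measurable_foldError s k) H.folds_pos hn v
    (half_pos hr)
  have hlast : ENNReal.ofReal (K ^ 2 * v ^ 2 / (r / 2)) = η := by
    rw [hv2, ← ENNReal.ofReal_coe_nnreal]
    congr 1
    field_simp
  rw [hlast] at key
  calc _ ≤ _ := measure_mono fun ω hω => ?_
    _ ≤ _ := (measure_union_le _ _).trans (add_le_add ((measure_union_le _ _).trans
        (add_le_add ((measure_union_le _ _).trans (add_le_add hn1 hn2)) hn4)) key)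
    _ = _ := by push_cast; ring
  have hω' : r ≤ ‖1 / (n : ℝ) * ∑ i, heldOutError P O S Qhat ghat n ω i ^ 2 - 0‖ := hω
  rw [sub_zero, Real.norm_of_nonneg (by positivity)] at hω'
  simp only [Set.mem_union, Set.mem_ofPred_eq]
  by_cases a1 : (δ : ℝ≥0∞) < outcomeError P Qhat (S n ω) fun i => O i ω
  · exact Or.inl (Or.inl (Or.inl a1))
  by_cases a2 : (δ : ℝ≥0∞) < propensityError P ghat (S n ω) fun i => O i ω
  · exact Or.inl (Or.inl (Or.inr a2))
  by_cases a3 : Positivity O S ghat ε n ω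
  · refine Or.inr ⟨hδv n ω a3 (not_lt.1 a1) (not_lt.1 a2), lt_of_lt_of_le ?_ hω'⟩
    linarith
  · exact Or.inl (Or.inr a3)

end Remainder

/-! ### Convergence in measure and in distribution; perturbation of the sample variance -/

section Convergence

variable {Ω : Type*} [MeasurableSpace Ω] {μ : Measure Ω}

lemma tendstoInMeasure_add_zero {X Y : ℕ → Ω → ℝ} (hX : TendstoInMeasure μ X atTop fun _ => 0)
    (hY : TendstoInMeasure μ Y atTop fun _ => 0) :
    TendstoInMeasure μ (fun n ω => X n ω + Y n ω) atTop fun _ => 0 := by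
  rw [tendstoInMeasure_iff_norm] at hX hY ⊢
  intro r hr
  have h := (hX (r / 2) (half_pos hr)).add (hY (r / 2) (half_pos hr))
  rw [add_zero] at h
  refine tendsto_of_tendsto_of_tendsto_of_le_of_le tendsto_const_nhds h (fun _ => zero_le)
    fun n => (measure_mono fun ω hω => ?_).trans (measure_union_le _ _)
  simp only [Set.mem_union, Set.mem_ofPred_eq, sub_zero] at hω ⊢
  by_contra! hcon
  linarith [norm_add_le (X n ω) (Y n ω)]

/-- Along almost surely convergent subsequences, continuity at the limit point alone suffices. This
covers inversion, which is discontinuous at 0. -/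
lemma tendstoInMeasure_comp_of_continuousAt [IsFiniteMeasure μ] {X : ℕ → Ω → ℝ} {c : ℝ}
    (hX : ∀ n, Measurable (X n)) (h : TendstoInMeasure μ X atTop fun _ => c) {g : ℝ → ℝ}
    (hg : Measurable g) (hgc : ContinuousAt g c) :
    TendstoInMeasure μ (fun n ω => g (X n ω)) atTop fun _ => g c := by
  rw [exists_seq_tendstoInMeasure_atTop_iff fun n => (hX n).aestronglyMeasurable] at h
  have hm (n : ℕ) : AEStronglyMeasurable (fun ω => g (X n ω)) μ :=
    (hg.comp (hX n)).aestronglyMeasurable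
  rw [exists_seq_tendstoInMeasure_atTop_iff hm]
  intro ns hns
  obtain ⟨ns', h1, h2⟩ := h ns hns
  exact ⟨ns', h1, h2.mono fun ω hω => hgc.tendsto.comp hω⟩

/-- Convergence in distribution depends on the limit only through its law. -/
lemma tendstoInDistribution_of_map_eq [IsProbabilityMeasure μ] {Ω₁ Ω₂ : Type*} [MeasurableSpace Ω₁]
    [MeasurableSpace Ω₂] {ν₁ : Measure Ω₁} {ν₂ : Measure Ω₂} [IsProbabilityMeasure ν₁]
    [IsProbabilityMeasure ν₂] {X : ℕ → Ω → ℝ} {Z₁ : Ω₁ → ℝ} {Z₂ : Ω₂ → ℝ}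
    (h : TendstoInDistribution X atTop Z₁ (fun _ => μ) ν₁) (hZ : AEMeasurable Z₂ ν₂)
    (hmap : ν₁.map Z₁ = ν₂.map Z₂) : TendstoInDistribution X atTop Z₂ (fun _ => μ) ν₂ where
  forall_aemeasurable := h.forall_aemeasurable
  aemeasurable_limit := hZ
  tendsto := by
    have := h.tendsto
    simp only [hmap] at this
    exact this

/-- The sample variance is a Lipschitz-type functional of the sample. -/
lemma abs_sampleVariance_sub_le {n : ℕ} (hn : 0 < n) (a h : Fin n → ℝ) :
    |1 / (n : ℝ) * ∑ i, (a i + h i - 1 / (n : ℝ) * ∑ j, (a j + h j)) ^ 2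
        - 1 / (n : ℝ) * ∑ i, a i ^ 2|
      ≤ 2 * (√(1 / (n : ℝ) * ∑ i, a i ^ 2) * √(1 / (n : ℝ) * ∑ i, h i ^ 2))
        + 1 / (n : ℝ) * ∑ i, h i ^ 2
        + (|1 / (n : ℝ) * ∑ i, a i| + √(1 / (n : ℝ) * ∑ i, h i ^ 2)) ^ 2 := by
  have hn' : (0 : ℝ) < n := by exact_mod_cast hn
  set A1 := 1 / (n : ℝ) * ∑ i, a i with hA1
  set A2 := 1 / (n : ℝ) * ∑ i, a i ^ 2 with hA2
  set H1 := 1 / (n : ℝ) * ∑ i, h i with hH1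
  set H2 := 1 / (n : ℝ) * ∑ i, h i ^ 2 with hH2
  set C := 1 / (n : ℝ) * ∑ i, a i * h i with hC
  have hA2' : 0 ≤ A2 := by positivity
  have hH2' : 0 ≤ H2 := by positivity
  have hm : 1 / (n : ℝ) * ∑ j, (a j + h j) = A1 + H1 := by
    rw [Finset.sum_add_distrib, mul_add]
  have hC' : |C| ≤ √A2 * √H2 := by
    rw [← Real.sqrt_mul hA2']
    refine Real.abs_le_sqrt ?_
    have := Finset.sum_mul_sq_le_sq_mul_sq Finset.univ a h
    rw [hC, hA2, hH2, mul_pow]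
    calc _ ≤ (1 / (n : ℝ)) ^ 2 * ((∑ i, a i ^ 2) * ∑ i, h i ^ 2) := by gcongr
      _ = _ := by ring
  have hH1' : |H1| ≤ √H2 := by
    refine Real.abs_le_sqrt ?_
    have := sq_sum_le_card_mul_sum_sq (s := Finset.univ) (f := h)
    rw [Finset.card_univ, Fintype.card_fin] at this
    rw [hH1, hH2, mul_pow]
    calc _ ≤ (1 / (n : ℝ)) ^ 2 * (n * ∑ i, h i ^ 2) := by gcongr
      _ = _ := by field_simp
  -- The mean square of `a` cancels exactly; Cauchy–Schwarz controls `C` and `H1` through `A2` and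
  -- `H2`.
  have e : 1 / (n : ℝ) * ∑ i, (a i + h i - (A1 + H1)) ^ 2 - A2 = 2 * C + H2 - (A1 + H1) ^ 2 := by
    have e1 : ∀ i, (a i + h i - (A1 + H1)) ^ 2 = a i ^ 2 + 2 * (a i * h i) + h i ^ 2
        - 2 * (A1 + H1) * (a i + h i) + (A1 + H1) ^ 2 := fun i => by ring
    have e2 : ∑ j, (a j + h j) = n * (A1 + H1) := by
      rw [← hm]; field_simp
    simp only [e1, Finset.sum_add_distrib, Finset.sum_sub_distrib, ← Finset.mul_sum]
    rw [← Finset.sum_add_distrib, e2, Finset.sum_const, Finset.card_univ, Fintype.card_fin,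
      nsmul_eq_mul]
    rw [hC, hA2, hH2]
    field_simp
    ring
  rw [hm, e]
  have h1 : (A1 + H1) ^ 2 ≤ (|A1| + √H2) ^ 2 := by
    rw [← sq_abs]
    gcongr
    exact (abs_add_le _ _).trans (by gcongr)
  rw [abs_le] at hC' ⊢
  constructor <;> nlinarith [sq_nonneg (A1 + H1), sq_nonneg (|A1| + √H2)]

/-- The frontier lies in the two endpoints, which an atomless law ignores. The portmanteau theorem
needs this for coverage. -/
lemma gaussianReal_frontier_Icc (z : ℝ) : gaussianReal 0 1 (frontier (Set.Icc (-z) z)) = 0 := by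
  have : NullSingletonClass (gaussianReal 0 1) := nullSingletonClass_gaussianReal one_ne_zero
  refine measure_mono_null (t := {-z, z}) ?_ ?_
  · intro x hx
    have h1 := isClosed_Icc.frontier_subset hx
    rw [frontier, interior_Icc] at hx
    by_contra hcon
    simp only [Set.mem_insert_iff, Set.mem_singleton_iff, not_or] at hcon
    exact hx.2 ⟨lt_of_le_of_ne h1.1 (Ne.symm hcon.1), lt_of_le_of_ne h1.2 hcon.2⟩
  · exact (Set.toFinite _).measure_zero _

end Convergence

/-! ### Consistency, asymptotic normality, standard error and coverage -/

section Estimator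

variable {𝓧 𝓦 Ω : Type*} [MeasurableSpace 𝓧] [MeasurableSpace 𝓦]
variable {P : Measure (Obs 𝓧 𝓦)} [IsProbabilityMeasure P]
variable {O : ℕ → Ω → Obs 𝓧 𝓦} {K : ℕ} {S : ∀ n : ℕ, Ω → (Fin n → Fin K)}
variable {Qhat : Learner 𝓧 𝓦 K (Fin 2 → 𝓦 × 𝓧 → ℝ)} {ghat : Learner 𝓧 𝓦 K (𝓦 × 𝓧 → ℝ)}
variable {ε₀ ε : ℝ}

variable (P) in
lemma heldOutScore_eq (n : ℕ) (ω : Ω) (i : Fin n) :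
    heldOutScore Qhat ghat (S n ω) (fun i => O i ω) i
      = psi P + influence P (O i ω) + heldOutError P O S Qhat ghat n ω i := by
  simp only [heldOutScore, heldOutError, foldError, scoreError, influence]
  ring

variable (P) in
lemma psiCF_eq {n : ℕ} (hn : 0 < n) (ω : Ω) :
    psiCF Qhat ghat (S n ω) (fun i => O i ω) = psi P + 1 / (n : ℝ) *
      ∑ i : Fin n, (influence P (O i ω) + heldOutError P O S Qhat ghat n ω i) := by
  have hn' : (n : ℝ) ≠ 0 := by exact_mod_cast hn.ne'
  rw [psiCF, ← sum_eq_sum_fold]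
  simp only [heldOutScore_eq P, add_assoc]
  rw [Finset.sum_add_distrib, Finset.sum_const, Finset.card_univ, Fintype.card_fin, nsmul_eq_mul]
  field_simp

variable (P) in
lemma sqrt_mul_seCF {n : ℕ} (hn : 0 < n) (ω : Ω) :
    √(n : ℝ) * seCF Qhat ghat (S n ω) (fun i => O i ω) = √(n / ((n : ℝ) - 1) *
      (1 / (n : ℝ) * ∑ i : Fin n, (influence P (O i ω) + heldOutError P O S Qhat ghat n ω i
        - 1 / (n : ℝ) * ∑ j : Fin n,
          (influence P (O j ω) + heldOutError P O S Qhat ghat n ω j)) ^ 2)) := by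
  have hn' : (n : ℝ) ≠ 0 := by exact_mod_cast hn.ne'
  rw [seCF, ← Real.sqrt_mul (by positivity)]
  congr 1
  rw [psiCF_eq P hn, ← mul_assoc, ← mul_assoc]
  congr 1
  -- The inverses are separated so that `n - 1` need not be nonzero; at `n = 1` both sides carry the
  -- inverse of 0.
  · rw [one_div, mul_inv]
    field_simp
  · refine Finset.sum_congr rfl fun i _ => ?_
    rw [heldOutScore_eq P]
    ring

variable [MeasurableSpace Ω] {μ : Measure Ω}

lemma isBigOP_outcomeError_of_isLittleOP
    (hQ : IsLittleOP μ (fun n ω => outcomeError P Qhat (S n ω) fun i => O i ω) (fun _ => 1)) :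
    IsBigOP μ (fun n ω => outcomeError P Qhat (S n ω) fun i => O i ω) (fun _ => 1) :=
  fun η hη => ⟨1, ENNReal.tendsto_nhds_zero.1 (hQ 1 one_pos) η (by exact_mod_cast hη)⟩

/-- A vanishing factor times a stochastically bounded one vanishes. -/
lemma isLittleOP_product_of_propensity
    (hg : IsLittleOP μ (fun n ω => propensityError P ghat (S n ω) fun i => O i ω) (fun _ => 1))
    (hQ : IsBigOP μ (fun n ω => outcomeError P Qhat (S n ω) fun i => O i ω) (fun _ => 1)) :
    IsLittleOP μ (fun n ω => propensityError P ghat (S n ω) (fun i => O i ω) *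
      outcomeError P Qhat (S n ω) fun i => O i ω) (fun _ => 1) := by
  intro δ hδ
  refine tendsto_zero_of_eventually_le_mul 2 fun η hη => ?_
  obtain ⟨M, hM⟩ := hQ η hη
  have h := ENNReal.tendsto_nhds_zero.1 (hg (δ / (M + 1)) (by positivity)) η
    (by exact_mod_cast hη)
  filter_upwards [hM, h] with n hn1 hn2
  refine (measure_mono fun ω hω => ?_).trans ((measure_union_le _ _).trans
    ((add_le_add hn1 hn2).trans_eq (by push_cast; ring)))
  simp only [Set.mem_union, Set.mem_ofPred_eq, mul_one] at hω ⊢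
  by_contra! hcon
  refine absurd hω (not_lt.2 ((mul_le_mul' hcon.2 hcon.1).trans ?_))
  rw [← ENNReal.coe_mul, ENNReal.coe_le_coe, div_mul_eq_mul_div]
  refine div_le_of_le_mul₀ (by positivity) (by positivity) ?_
  gcongr
  exact le_self_add

variable (H : CrossFitSetup P μ O S Qhat ghat ε₀ ε)
include H

lemma CrossFitSetup.measurable_heldOutScore {n : ℕ} (s : Fin n → Fin K) (i : Fin n) :
    Measurable fun d : Fin n → Obs 𝓧 𝓦 => heldOutScore Qhat ghat s d i := by
  have h1 : Measurable fun p : Training 𝓧 𝓦 s (s i) × Obs 𝓧 𝓦 =>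
      score (Qhat n s (s i) p.1) (ghat n s (s i) p.1) p.2 :=
    measurable_score_param (H.Qhat_meas n s (s i)) (H.ghat_meas n s (s i))
  have h2 : Measurable fun d : Fin n → Obs 𝓧 𝓦 => (training s (s i) d, d i) :=
    (measurable_training s (s i)).prodMk (measurable_pi_apply i)
  have h3 := h1.comp h2
  simp only [Function.comp_def] at h3
  exact h3

/-- The space of partitions is finite, so measurability in the data for each partition yields joint
measurability. -/
lemma CrossFitSetup.measurable_comp_sample {n : ℕ}
    {f : (Fin n → Fin K) → (Fin n → Obs 𝓧 𝓦) → ℝ} (hf : ∀ s, Measurable (f s)) :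
    Measurable fun ω => f (S n ω) fun i => O i ω := by
  have h : Measurable fun p : (Fin n → Fin K) × (Fin n → Obs 𝓧 𝓦) => f p.1 p.2 :=
    measurable_from_prod_countable_right hf
  exact h.comp ((H.part_meas n).prodMk (measurable_pi_lambda _ fun i => H.obs_meas i))

lemma CrossFitSetup.measurable_psiCF (n : ℕ) :
    Measurable fun ω => psiCF Qhat ghat (S n ω) fun i => O i ω := by
  refine H.measurable_comp_sample (f := fun s d => psiCF Qhat ghat s d) fun s => ?_
  exact (Finset.measurable_sum _ fun k _ => Finset.measurable_sum _ fun i _ =>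
    H.measurable_heldOutScore s i).const_mul _

lemma CrossFitSetup.measurable_seCF (n : ℕ) :
    Measurable fun ω => seCF Qhat ghat (S n ω) fun i => O i ω := by
  refine H.measurable_comp_sample (f := fun s d => seCF Qhat ghat s d) fun s => ?_
  have hψ : Measurable fun d : Fin n → Obs 𝓧 𝓦 => psiCF Qhat ghat s d :=
    (Finset.measurable_sum _ fun k _ => Finset.measurable_sum _ fun i _ =>
      H.measurable_heldOutScore s i).const_mul _
  exact ((Finset.measurable_sum _ fun i _ =>
    ((H.measurable_heldOutScore s i).sub hψ).pow_const 2).const_mul _).sqrt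

lemma CrossFitSetup.identDistrib_obs (i : ℕ) : IdentDistrib (O i) (O 0) μ μ :=
  ⟨(H.obs_meas i).aemeasurable, (H.obs_meas 0).aemeasurable, by rw [H.obs_law, H.obs_law]⟩

lemma CrossFitSetup.memLp_influence_obs (i : ℕ) : MemLp (fun ω => influence P (O i ω)) 2 μ := by
  have h := memLp_influence P H.outcome_memLp H.outcomeReg_memLp H.propensity_lb
    H.propensity_bounds
  exact h.comp_measurePreserving ⟨H.obs_meas i, H.obs_law i⟩

lemma CrossFitSetup.integral_comp_obs (i : ℕ) {f : Obs 𝓧 𝓦 → ℝ} (hf : Measurable f) :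
    ∫ ω, f (O i ω) ∂μ = ∫ o, f o ∂P := by
  rw [← H.obs_law i, integral_map (H.obs_meas i).aemeasurable hf.aestronglyMeasurable]

lemma CrossFitSetup.integral_influence_eq_zero : ∫ o, influence P o ∂P = 0 :=
  integral_influence P H.outcome_memLp H.outcomeReg_memLp H.propensity_lb H.propensity_bounds

lemma CrossFitSetup.ae_tendsto_mean {f : Obs 𝓧 𝓦 → ℝ} (hf : Measurable f)
    (hi : Integrable (fun ω => f (O 0 ω)) μ) :
    ∀ᵐ ω ∂μ, Tendsto (fun n : ℕ => 1 / (n : ℝ) * ∑ i : Fin n, f (O i ω)) atTop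
      (𝓝 (∫ o, f o ∂P)) := by
  have h := strong_law_ae_real (fun i ω => f (O i ω)) hi
    (fun i j hij => (H.obs_indep.indepFun hij).comp hf hf)
    (fun i => (H.identDistrib_obs i).comp hf)
  filter_upwards [h] with ω hω
  rw [H.integral_comp_obs 0 hf] at hω
  refine hω.congr fun n => ?_
  rw [Finset.sum_range (fun i => f (O i ω)), div_eq_inv_mul, one_div]

lemma CrossFitSetup.ae_tendsto_mean_influence [IsProbabilityMeasure μ] :
    ∀ᵐ ω ∂μ, Tendsto (fun n : ℕ => 1 / (n : ℝ) * ∑ i : Fin n, influence P (O i ω)) atTop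
      (𝓝 0) := by
  have := H.ae_tendsto_mean (measurable_influence P)
    ((H.memLp_influence_obs 0).integrable one_le_two)
  rwa [H.integral_influence_eq_zero] at this

lemma CrossFitSetup.ae_tendsto_mean_influence_sq [IsProbabilityMeasure μ] :
    ∀ᵐ ω ∂μ, Tendsto (fun n : ℕ => 1 / (n : ℝ) * ∑ i : Fin n, influence P (O i ω) ^ 2) atTop
      (𝓝 (Var[influence P; P])) := by
  have := H.ae_tendsto_mean ((measurable_influence P).pow_const 2)
    (H.memLp_influence_obs 0).integrable_sq
  rwa [variance_of_integral_eq_zero (measurable_influence P).aemeasurable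
    H.integral_influence_eq_zero]

/-- Double robustness: consistency when the product of the nuisance errors vanishes. -/
lemma CrossFitSetup.tendstoInMeasure_psiCF [IsProbabilityMeasure μ]
    (hQ : IsBigOP μ (fun n ω => outcomeError P Qhat (S n ω) fun i => O i ω) (fun _ => 1))
    (hprod : IsLittleOP μ (fun n ω => propensityError P ghat (S n ω) (fun i => O i ω) *
      outcomeError P Qhat (S n ω) fun i => O i ω) (fun _ => 1)) :
    TendstoInMeasure μ (fun n ω => psiCF Qhat ghat (S n ω) fun i => O i ω) atTop
      (fun _ => psi P) := by
  have h1 : TendstoInMeasure μ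
      (fun (n : ℕ) ω => 1 / (n : ℝ) * ∑ i : Fin n, influence P (O i ω)) atTop fun _ => 0 := by
    refine tendstoInMeasure_of_tendsto_ae (fun n => ?_) H.ae_tendsto_mean_influence
    have hi (i : Fin n) : Measurable fun ω => influence P (O i ω) :=
      (measurable_influence P).comp (H.obs_meas i)
    exact ((Finset.measurable_sum _ fun i _ => hi i).const_mul _).aestronglyMeasurable
  have h2 := tendstoInMeasure_add_zero h1 (H.tendstoInMeasure_mean_heldOutError hQ hprod)
  rw [tendstoInMeasure_iff_norm] at h2 ⊢
  intro r hr
  refine (h2 r hr).congr' ?_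
  filter_upwards [eventually_gt_atTop 0] with n hn
  congr 1
  ext ω
  simp only [Set.mem_ofPred_eq]
  rw [psiCF_eq P hn, Finset.sum_add_distrib, mul_add, add_sub_cancel_left, sub_zero]

lemma CrossFitSetup.propensityError_le_one {n : ℕ} {ω : Ω} (hω : Positivity O S ghat ε n ω) :
    propensityError P ghat (S n ω) (fun i => O i ω) ≤ 1 := by
  refine iSup_le fun k => ?_
  refine (eLpNorm_le_of_ae_bound (C := 1) (ae_of_all _ fun o =>
    abs_sub_propensity_le_one P H.ghat_lb (hω k) (covs o))).trans ?_
  simp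

/-- Under positivity the propensity error is at most 1, so the product inherits smallness from the
outcome error even when the propensity is estimated inconsistently. -/
lemma CrossFitSetup.isLittleOP_product_of_outcome
    (hQ : IsLittleOP μ (fun n ω => outcomeError P Qhat (S n ω) fun i => O i ω) (fun _ => 1)) :
    IsLittleOP μ (fun n ω => propensityError P ghat (S n ω) (fun i => O i ω) *
      outcomeError P Qhat (S n ω) fun i => O i ω) (fun _ => 1) := by
  intro δ hδ
  have h := H.ghat_bounds.add (hQ δ hδ)
  rw [add_zero] at h
  refine tendsto_of_tendsto_of_tendsto_of_le_of_le tendsto_const_nhds h (fun _ => zero_le)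
    fun n => (measure_mono fun ω hω => ?_).trans (measure_union_le _ _)
  by_cases hp : Positivity O S ghat ε n ω
  · right
    simp only [Set.mem_ofPred_eq] at hω ⊢
    exact hω.trans_le (mul_le_of_le_one_left zero_le (H.propensityError_le_one hp))
  · exact Or.inl hp

/-- By the triangle inequality the error exceeds the size of the fit by at most the fixed finite
norm of the true regressions. -/
lemma CrossFitSetup.isBigOP_outcomeError_of_size
    (hQ : IsBigOP μ (fun n ω => outcomeSize P Qhat (S n ω) fun i => O i ω) (fun _ => 1)) :
    IsBigOP μ (fun n ω => outcomeError P Qhat (S n ω) fun i => O i ω) (fun _ => 1) := by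
  have hfin : ∑ a, l2norm P (outcomeReg P a) ≠ ∞ :=
    (ENNReal.sum_lt_top.2 fun a _ => (H.outcomeReg_memLp a).2).ne
  have hle (n : ℕ) (ω : Ω) : outcomeError P Qhat (S n ω) (fun i => O i ω)
      ≤ outcomeSize P Qhat (S n ω) (fun i => O i ω) + ∑ a, l2norm P (outcomeReg P a) := by
    refine iSup_le fun k => ?_
    refine le_trans ?_ (add_le_add_left (le_iSup (fun k => ∑ a, l2norm P
      (Qhat n (S n ω) k (training (S n ω) k fun i => O i ω) a)) k) _)
    rw [← Finset.sum_add_distrib]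
    refine Finset.sum_le_sum fun a _ => ?_
    exact eLpNorm_sub_le ((H.measurable_Qhat _ _ _ a).comp measurable_covs).aestronglyMeasurable
      ((measurable_outcomeReg P a).comp measurable_covs).aestronglyMeasurable one_le_two
  intro η hη
  obtain ⟨M, hM⟩ := hQ η hη
  refine ⟨M + (∑ a, l2norm P (outcomeReg P a)).toNNReal, ?_⟩
  filter_upwards [hM] with n hn
  refine (measure_mono fun ω hω => ?_).trans hn
  simp only [Set.mem_ofPred_eq, mul_one, ENNReal.coe_add, ENNReal.coe_toNNReal hfin] at hω ⊢
  exact lt_of_add_lt_add_right (hω.trans_le (hle n ω))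

/-- The oracle central limit theorem. -/
lemma CrossFitSetup.tendstoInDistribution_influence [IsProbabilityMeasure μ] :
    TendstoInDistribution
      (fun (n : ℕ) ω => √(n : ℝ) * (1 / (n : ℝ) * ∑ i : Fin n, influence P (O i ω))) atTop
      (id : ℝ → ℝ) (fun _ => μ) (gaussianReal 0 (Var[influence P; P]).toNNReal) := by
  have hvar : Var[fun ω => influence P (O 0 ω); μ] = Var[influence P; P] := by
    have h := variance_map (μ := μ) (Y := O 0) (X := influence P)
      (measurable_influence P).aemeasurable (H.obs_meas 0).aemeasurable
    rw [H.obs_law 0] at h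
    exact h.symm
  have hmean : ∫ ω, influence P (O 0 ω) ∂μ = 0 := by
    rw [H.integral_comp_obs 0 (measurable_influence P), H.integral_influence_eq_zero]
  have hlaw : HasLaw (id : ℝ → ℝ) (gaussianReal 0 (Var[fun ω => influence P (O 0 ω); μ]).toNNReal)
      (gaussianReal 0 (Var[influence P; P]).toNNReal) := by
    rw [hvar]
    exact ⟨aemeasurable_id, Measure.map_id⟩
  have h := tendstoInDistribution_inv_sqrt_mul_sum_sub (X := fun i ω => influence P (O i ω))
    hlaw (H.memLp_influence_obs 0) (H.obs_indep.comp _ fun _ => measurable_influence P)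
    (fun i => (H.identDistrib_obs i).comp (measurable_influence P))
  refine h.congr (fun n => ae_of_all _ fun ω => ?_) (ae_eq_refl _)
  simp only [hmean, mul_zero, sub_zero]
  rw [Finset.sum_range (fun i => influence P (O i ω)), ← mul_assoc, mul_one_div,
    Real.sqrt_div_self]

/-- Asymptotic normality of the cross-fitted estimator. -/
lemma CrossFitSetup.tendstoInDistribution_psiCF [IsProbabilityMeasure μ]
    (hQ : IsLittleOP μ (fun n ω => outcomeError P Qhat (S n ω) fun i => O i ω) (fun _ => 1))
    (hg : IsLittleOP μ (fun n ω => propensityError P ghat (S n ω) fun i => O i ω) (fun _ => 1))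
    (hprod : IsLittleOP μ (fun n ω => propensityError P ghat (S n ω) (fun i => O i ω) *
      outcomeError P Qhat (S n ω) fun i => O i ω) (fun n => (n : ℝ≥0∞) ^ (-(1 / 2) : ℝ))) :
    TendstoInDistribution
      (fun (n : ℕ) ω => √(n : ℝ) * (psiCF Qhat ghat (S n ω) (fun i => O i ω) - psi P)) atTop
      (id : ℝ → ℝ) (fun _ => μ) (gaussianReal 0 (Var[influence P; P]).toNNReal) := by
  -- Slutsky: the difference from the oracle average is √n times the mean held-out error.
  refine tendstoInDistribution_of_tendstoInMeasure_sub _ _ H.tendstoInDistribution_influence ?_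
    fun n => (((H.measurable_psiCF n).sub_const _).const_mul _).aemeasurable
  refine (H.tendstoInMeasure_sqrt_mul_mean_heldOutError hQ hg hprod).congr' ?_ (ae_eq_refl _)
  filter_upwards [eventually_gt_atTop 0] with n hn
  refine ae_of_all _ fun ω => ?_
  simp only [Pi.sub_apply]
  rw [psiCF_eq P hn, Finset.sum_add_distrib]
  ring

/-- Consistency of the scaled standard error. -/
lemma CrossFitSetup.tendstoInMeasure_sqrt_mul_seCF [IsProbabilityMeasure μ]
    (hQ : IsLittleOP μ (fun n ω => outcomeError P Qhat (S n ω) fun i => O i ω) (fun _ => 1))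
    (hg : IsLittleOP μ (fun n ω => propensityError P ghat (S n ω) fun i => O i ω) (fun _ => 1)) :
    TendstoInMeasure μ
      (fun (n : ℕ) ω => √(n : ℝ) * seCF Qhat ghat (S n ω) fun i => O i ω) atTop
      (fun _ => √(Var[influence P; P])) := by
  have h0 := H.tendstoInMeasure_mean_sq_heldOutError hQ hg
  rw [exists_seq_tendstoInMeasure_atTop_iff
    fun n => ((H.measurable_seCF n).const_mul _).aestronglyMeasurable]
  intro ns hns
  -- A further subsequence makes the mean squared error converge almost surely; the strong laws
  -- already hold along the full sequence, so the remaining argument is deterministic for each `ω`.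
  obtain ⟨ns', hns', hae⟩ := (h0.comp hns.tendsto_atTop).exists_seq_tendsto_ae
  refine ⟨ns', hns', ?_⟩
  have hsub : Tendsto (fun i => ns (ns' i)) atTop atTop :=
    hns.tendsto_atTop.comp hns'.tendsto_atTop
  filter_upwards [hae, H.ae_tendsto_mean_influence, H.ae_tendsto_mean_influence_sq]
    with ω hH hA1 hA2
  replace hA1 := hA1.comp hsub
  replace hA2 := hA2.comp hsub
  simp only [Function.comp_def] at hH hA1 hA2
  have hHs := hH.sqrt
  have hbound := (((hA2.sqrt.mul hHs).const_mul 2).add hH).add ((hA1.abs.add hHs).pow 2)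
  simp only [Real.sqrt_zero, mul_zero, abs_zero, add_zero, ne_eq, OfNat.ofNat_ne_zero,
    not_false_eq_true, zero_pow] at hbound
  have hV := (tendsto_iff_norm_sub_tendsto_zero (b := (0 : ℝ))).2
    (squeeze_zero' (Eventually.of_forall fun _ => norm_nonneg _) (by
      filter_upwards [hsub.eventually_gt_atTop 0] with i hi
      rw [sub_zero]
      exact abs_sampleVariance_sub_le hi (fun j : Fin (ns (ns' i)) => influence P (O j ω))
        (heldOutError P O S Qhat ghat (ns (ns' i)) ω)) hbound)
  have hV' := hV.add hA2
  simp only [sub_add_cancel, zero_add] at hV'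
  -- The correction for the `n - 1` in the standard error.
  have hfac : Tendsto (fun i => ((ns (ns' i) : ℕ) : ℝ) / ((ns (ns' i) : ℝ) - 1)) atTop (𝓝 1) := by
    have := (tendsto_natCast_div_add_atTop (𝕜 := ℝ) (-1)).comp hsub
    simpa only [Function.comp_def, ← sub_eq_add_neg] using this
  have hfin := (hfac.mul hV').sqrt
  rw [one_mul] at hfin
  refine hfin.congr' ?_
  filter_upwards [hsub.eventually_gt_atTop 0] with i hi
  rw [sqrt_mul_seCF P hi]

/-- Asymptotic normality of the studentized estimator. -/
lemma CrossFitSetup.tendstoInDistribution_studentized [IsProbabilityMeasure μ]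
    (hQ : IsLittleOP μ (fun n ω => outcomeError P Qhat (S n ω) fun i => O i ω) (fun _ => 1))
    (hg : IsLittleOP μ (fun n ω => propensityError P ghat (S n ω) fun i => O i ω) (fun _ => 1))
    (hprod : IsLittleOP μ (fun n ω => propensityError P ghat (S n ω) (fun i => O i ω) *
      outcomeError P Qhat (S n ω) fun i => O i ω) (fun n => (n : ℝ≥0∞) ^ (-(1 / 2) : ℝ)))
    (hσ : 0 < Var[influence P; P]) :
    TendstoInDistribution (fun n ω => (psiCF Qhat ghat (S n ω) (fun i => O i ω) - psi P) /
        seCF Qhat ghat (S n ω) fun i => O i ω) atTop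
      (id : ℝ → ℝ) (fun _ => μ) (gaussianReal 0 1) := by
  have hσ' : 0 < √(Var[influence P; P]) := Real.sqrt_pos.2 hσ
  have hm (n : ℕ) : Measurable fun ω => √(n : ℝ) * seCF Qhat ghat (S n ω) fun i => O i ω :=
    (H.measurable_seCF n).const_mul _
  have hinv := tendstoInMeasure_comp_of_continuousAt hm (H.tendstoInMeasure_sqrt_mul_seCF hQ hg)
    measurable_inv (continuousAt_inv₀ hσ'.ne')
  have hψ := H.tendstoInDistribution_psiCF hQ hg hprod
  have h := hψ.continuous_comp_prodMk_of_tendstoInMeasure_const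
    (g := fun x : ℝ × ℝ => x.1 * x.2) (by fun_prop) hinv fun n => (hm n).inv.aemeasurable
  refine tendstoInDistribution_of_map_eq (h.congr (fun n => ae_of_all _ fun ω => ?_)
    (ae_eq_refl _)) aemeasurable_id ?_
  · change √(n : ℝ) * _ * (√(n : ℝ) * _)⁻¹ = _
    -- The factors √n cancel only for positive `n`; at `n = 0` both sides are 0 by the convention
    -- for division by zero.
    rcases Nat.eq_zero_or_pos n with rfl | hn
    · simp [seCF]
    · have : √(n : ℝ) ≠ 0 := (Real.sqrt_pos.2 (by exact_mod_cast hn)).ne'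
      rw [← div_eq_mul_inv, mul_div_mul_left _ _ this]
  · rw [Measure.map_id]
    change Measure.map (fun x : ℝ => x * (√(Var[influence P; P]))⁻¹) _ = _
    rw [gaussianReal_map_mul_const, mul_zero]
    congr 1
    rw [← NNReal.coe_inj]
    push_cast
    rw [Real.coe_toNNReal _ hσ.le]
    simp only [inv_pow, Real.sq_sqrt hσ.le]
    exact inv_mul_cancel₀ hσ.ne'

/-- Asymptotic coverage of the Wald interval. -/
lemma CrossFitSetup.tendsto_coverage [IsProbabilityMeasure μ]
    (hQ : IsLittleOP μ (fun n ω => outcomeError P Qhat (S n ω) fun i => O i ω) (fun _ => 1))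
    (hg : IsLittleOP μ (fun n ω => propensityError P ghat (S n ω) fun i => O i ω) (fun _ => 1))
    (hprod : IsLittleOP μ (fun n ω => propensityError P ghat (S n ω) (fun i => O i ω) *
      outcomeError P Qhat (S n ω) fun i => O i ω) (fun n => (n : ℝ≥0∞) ^ (-(1 / 2) : ℝ)))
    (hσ : 0 < Var[influence P; P]) (z : ℝ) :
    Tendsto (fun n => μ {ω | psi P ∈ Set.Icc
        (psiCF Qhat ghat (S n ω) (fun i => O i ω) - z * seCF Qhat ghat (S n ω) fun i => O i ω)
        (psiCF Qhat ghat (S n ω) (fun i => O i ω) + z * seCF Qhat ghat (S n ω) fun i => O i ω)})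
      atTop (𝓝 (gaussianReal 0 1 (Set.Icc (-z) z))) := by
  have hσ' : 0 < √(Var[influence P; P]) := Real.sqrt_pos.2 hσ
  have hT := H.tendstoInDistribution_studentized hQ hg hprod hσ
  have hlim := ProbabilityMeasure.tendsto_measure_of_null_frontier_of_tendsto' hT.tendsto
    (E := Set.Icc (-z) z) (by
      rw [ProbabilityMeasure.coe_mk, Measure.map_id]
      exact gaussianReal_frontier_Icc z)
  simp only [ProbabilityMeasure.coe_mk, Measure.map_id] at hlim
  have hD (n : ℕ) := Measure.map_apply_of_aemeasurable (hT.forall_aemeasurable n)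
    (measurableSet_Icc (a := -z) (b := z))
  simp only [hD] at hlim
  -- The radius is σ itself: a zero standard error lies at distance exactly σ from the limit. Off
  -- this vanishing event the standard error is positive, so covering ψ(P) is equivalent to the
  -- studentized statistic lying in `[-z, z]`.
  have hN := tendstoInMeasure_iff_norm.1 (H.tendstoInMeasure_sqrt_mul_seCF hQ hg) _ hσ'
  have hagree (n : ℕ) (ω : Ω)
      (hω : ¬ √(Var[influence P; P]) ≤ ‖√(n : ℝ) * seCF Qhat ghat (S n ω) (fun i => O i ω)
        - √(Var[influence P; P])‖) :
      psi P ∈ Set.Icc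
        (psiCF Qhat ghat (S n ω) (fun i => O i ω) - z * seCF Qhat ghat (S n ω) fun i => O i ω)
        (psiCF Qhat ghat (S n ω) (fun i => O i ω) + z * seCF Qhat ghat (S n ω) fun i => O i ω)
      ↔ (psiCF Qhat ghat (S n ω) (fun i => O i ω) - psi P) /
        seCF Qhat ghat (S n ω) (fun i => O i ω) ∈ Set.Icc (-z) z := by
    have hpos : 0 < seCF Qhat ghat (S n ω) fun i => O i ω := by
      refine lt_of_le_of_ne (Real.sqrt_nonneg _) fun h0 => hω ?_
      rw [← h0, mul_zero, zero_sub, norm_neg, Real.norm_of_nonneg hσ'.le]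
    rw [Set.mem_Icc, Set.mem_Icc, le_div_iff₀ hpos, div_le_iff₀ hpos]
    constructor <;> rintro ⟨h1, h2⟩ <;> constructor <;> linarith
  have hup := hlim.add hN
  -- Coverage is squeezed between the studentized probability plus and minus that of the exceptional
  -- event; the subtraction is continuous here because the second limit is finite.
  have hlo := ENNReal.Tendsto.sub hlim hN (Or.inr ENNReal.zero_ne_top)
  rw [add_zero] at hup
  rw [tsub_zero] at hlo
  refine tendsto_of_tendsto_of_tendsto_of_le_of_le hlo hup (fun n => ?_) fun n => ?_
  · refine tsub_le_iff_right.2 ((measure_mono fun ω hω => ?_).trans (measure_union_le _ _))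
    by_cases hn : √(Var[influence P; P]) ≤ ‖√(n : ℝ) * seCF Qhat ghat (S n ω) (fun i => O i ω)
        - √(Var[influence P; P])‖
    · exact Or.inr hn
    · exact Or.inl ((hagree n ω hn).2 hω)
  · refine (measure_mono fun ω hω => ?_).trans (measure_union_le _ _)
    by_cases hn : √(Var[influence P; P]) ≤ ‖√(n : ℝ) * seCF Qhat ghat (S n ω) (fun i => O i ω)
        - √(Var[influence P; P])‖
    · exact Or.inr hn
    · exact Or.inl ((hagree n ω hn).1 hω)

end Estimator

end DirectEffect

theorem mainTheorem7
    {𝓧 𝓦 Ω : Type*} [MeasurableSpace 𝓧] [MeasurableSpace 𝓦] [MeasurableSpace Ω]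
    -- the observed-data law and the i.i.d. sample
    (P : Measure (DirectEffect.Obs 𝓧 𝓦)) [IsProbabilityMeasure P]
    (μ : Measure Ω) [IsProbabilityMeasure μ]
    (O : ℕ → Ω → DirectEffect.Obs 𝓧 𝓦)
    (hO_meas : ∀ i, Measurable (O i))
    (hO_law : ∀ i, μ.map (O i) = P)
    (hO_indep : iIndepFun O μ)
    -- the random partition into `K` approximately equal folds, drawn independently of the data
    (K : ℕ) (hK : 2 ≤ K)
    (S : ∀ n : ℕ, Ω → (Fin n → Fin K))
    (hS_meas : ∀ n, Measurable (S n))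
    (hS_indep : ∀ n, IndepFun (S n) (fun ω (i : Fin n) => O i ω) μ)
    (hS_size : ∀ k : Fin K, TendstoInMeasure μ
      (fun n ω => ((DirectEffect.fold (S n ω) k).card : ℝ) / (n : ℝ)) atTop
      (fun _ => 1 / (K : ℝ)))
    -- the nuisance estimators
    (Qhat : DirectEffect.Learner 𝓧 𝓦 K (Fin 2 → 𝓦 × 𝓧 → ℝ))
    (ghat : DirectEffect.Learner 𝓧 𝓦 K (𝓦 × 𝓧 → ℝ))
    (hQhat_meas : ∀ (n : ℕ) (s : Fin n → Fin K) (k : Fin K) (a : Fin 2),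
      Measurable fun p : DirectEffect.Training 𝓧 𝓦 s k × (𝓦 × 𝓧) => Qhat n s k p.1 a p.2)
    (hghat_meas : ∀ (n : ℕ) (s : Fin n → Fin K) (k : Fin K),
      Measurable fun p : DirectEffect.Training 𝓧 𝓦 s k × (𝓦 × 𝓧) => ghat n s k p.1 p.2)
    -- square integrability and positivity
    (hY : MemLp (DirectEffect.outcome : DirectEffect.Obs 𝓧 𝓦 → ℝ) 2 P)
    (hQ : ∀ a : Fin 2, MemLp (fun o => DirectEffect.outcomeReg P a (DirectEffect.covs o)) 2 P)
    (ε₀ : ℝ) (hε₀ : 0 < ε₀)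
    (hg₀ : ∀ᵐ o ∂P, ε₀ ≤ DirectEffect.propensity P (DirectEffect.covs o) ∧
      DirectEffect.propensity P (DirectEffect.covs o) ≤ 1 - ε₀)
    (ε : ℝ) (hε : 0 < ε)
    (hghat : Tendsto (fun n : ℕ => μ {ω | ¬ ∀ (k : Fin K) (wx : 𝓦 × 𝓧),
        ε ≤ ghat n (S n ω) k (DirectEffect.training (S n ω) k fun i => O i ω) wx ∧
        ghat n (S n ω) k (DirectEffect.training (S n ω) k fun i => O i ω) wx ≤ 1 - ε})
      atTop (𝓝 0)) :
    let Qerr : ℕ → Ω → ℝ≥0∞ := fun n ω =>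
      DirectEffect.outcomeError P Qhat (S n ω) fun i => O i ω
    let Qsize : ℕ → Ω → ℝ≥0∞ := fun n ω =>
      DirectEffect.outcomeSize P Qhat (S n ω) fun i => O i ω
    let gerr : ℕ → Ω → ℝ≥0∞ := fun n ω =>
      DirectEffect.propensityError P ghat (S n ω) fun i => O i ω
    let est : ℕ → Ω → ℝ := fun n ω => DirectEffect.psiCF Qhat ghat (S n ω) fun i => O i ω
    let se : ℕ → Ω → ℝ := fun n ω => DirectEffect.seCF Qhat ghat (S n ω) fun i => O i ω
    let σ2 : ℝ := variance (DirectEffect.influence P) P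
    -- (i) double robustness
    ((DirectEffect.IsLittleOP μ Qerr (fun _ => 1) ∨
        (DirectEffect.IsLittleOP μ gerr (fun _ => 1) ∧
          DirectEffect.IsBigOP μ Qsize (fun _ => 1))) →
      TendstoInMeasure μ est atTop (fun _ => DirectEffect.psi P)) ∧
    -- (ii) asymptotic normality and validity of the standard error
    (DirectEffect.IsLittleOP μ Qerr (fun _ => 1) →
      DirectEffect.IsLittleOP μ gerr (fun _ => 1) →
      DirectEffect.IsLittleOP μ (fun n ω => gerr n ω * Qerr n ω)
        (fun n => (n : ℝ≥0∞) ^ (-(1 / 2) : ℝ)) →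
      MemLp (DirectEffect.influence P) 2 P ∧
      TendstoInDistribution (fun (n : ℕ) ω => √(n : ℝ) * (est n ω - DirectEffect.psi P)) atTop
        (id : ℝ → ℝ) (fun _ => μ) (gaussianReal 0 σ2.toNNReal) ∧
      TendstoInMeasure μ (fun (n : ℕ) ω => √(n : ℝ) * se n ω) atTop (fun _ => √σ2) ∧
      (0 < σ2 →
        TendstoInDistribution (fun n ω => (est n ω - DirectEffect.psi P) / se n ω) atTop
          (id : ℝ → ℝ) (fun _ => μ) (gaussianReal 0 1) ∧
        ∀ z : ℝ, 0 < z → Tendsto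
          (fun n => μ {ω | DirectEffect.psi P ∈
            Set.Icc (est n ω - z * se n ω) (est n ω + z * se n ω)}) atTop
          (𝓝 (gaussianReal 0 1 (Set.Icc (-z) z))))) := by
  have H : DirectEffect.CrossFitSetup P μ O S Qhat ghat ε₀ ε :=
    ⟨hO_meas, hO_law, hO_indep, by omega, hS_meas, hS_indep, hQhat_meas, hghat_meas, hY, hQ, hε₀,
      hg₀, hε, hghat⟩
  intro Qerr Qsize gerr est se σ2
  refine ⟨?_, fun hQe hge hprod => ⟨?_, ?_, ?_, fun hσ => ⟨?_, fun z _ => ?_⟩⟩⟩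
  -- Both alternatives reduce to the same pair of conditions: e_Q = O_P(1) and e_g e_Q = o_P(1).
  · rintro (hQe | ⟨hge, hQs⟩)
    · exact H.tendstoInMeasure_psiCF (DirectEffect.isBigOP_outcomeError_of_isLittleOP hQe)
        (H.isLittleOP_product_of_outcome hQe)
    · have hQe := H.isBigOP_outcomeError_of_size hQs
      exact H.tendstoInMeasure_psiCF hQe (DirectEffect.isLittleOP_product_of_propensity hge hQe)
  · exact DirectEffect.memLp_influence P hY hQ hε₀ hg₀
  · exact H.tendstoInDistribution_psiCF hQe hge hprod
  · exact H.tendstoInMeasure_sqrt_mul_seCF hQe hge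
  · exact H.tendstoInDistribution_studentized hQe hge hprod hσ
  · exact H.tendsto_coverage hQe hge hprod hσ z
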